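/- Let $I\ge 1$, $m\ge 0$, and consider $\min_{x\in K}U(x)=F(x)+G^+(x)-G^-(x)$, $F=\sum_{i=1}^I f_i$, where: - $K\subseteq\mathbb R^m$ is nonempty, closed and convex, and $O\supseteq K$ is open; - each $f_i:O\to\mathbb R$ is $C^1$ and $\nabla f_i$ is $L_i$-Lipschitz on $K$; - $G^+:K\to\mathbb R$ is convex and lower semicontinuous; $G^-:O\to\mathbb R$ is $C^1$ and $\nabla G^-$ is $L_G$-Lipschitz on $K$; - $U$ is bounded below on $K$. **Network.** Let $(\mathcal G^n)_{n\ge0}$ be digraphs on $\{1,\dots,I\}$ with edge sets $\mathcal E^n$ such that, for some integer $B>0$ and all $k\ge 0$, the digraph with edge set $\bigcup_{t=k}^{k+B-1}\mathcal E^t$ is strongly connected. Let $A^n=(a^n_{ij})$ be matrices with columns summing to $1$ and, for a fixed $\kappa>0$: $a^n_{ii}\ge\kappa$; for $i\ne j$, $a^n_{ij}\ge\kappa$ if $(j,i)\in\mathcal E^n$ and $a^n_{ij}=0$ otherwise. **Surrogates.** Let $\tilde f_i:K\times K\to\mathbb R$ be $C^1$ in the first argument, with partial gradient $\nabla\tilde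 f_i(x;y)$ in $x$, such that for all $x,y\in K$: $\nabla\tilde f_i(x;x)=\nabla f_i(x)$; $\tilde f_i(\cdot\,;y)$ is strongly convex on $K$ with constant $\tau_i>0$; $\nabla\tilde f_i(x;\cdot)$ is $\tilde L_i$-Lipschitz on $K$. **Algorithm (SONATA, constant step-size $\alpha>0$).** Start from $x^0_{(i)}\in K$, $\phi^0_i=1$, $y^0_{(i)}=\nabla f_i(x^0_{(i)})$, and for all $n\ge0$ and all $i$ set $$\tilde x^n_{(i)}=\operatorname*{argmin}_{z\in K}\Big\{\tilde f_i(z;x^n_{(i)})-\nabla G^-(x^n_{(i)})^\top(z-x^n_{(i)})+\big(I\,y^n_{(i)}-\nabla f_i(x^n_{(i)})\big)^\top(z-x^n_{(i)})+G^+(z)\Big\},$$ $$\phi_i^{n+1}=\sum_j a^n_{ij}\phi^n_j,\qquad x^{n+1}_{(i)}=\frac1{\phi_i^{n+1}}\sum_j a^n_{ij}\phi^n_j\big(x^n_{(j)}+\alpha(\tilde x^n_{(j)}-x^n_{(j)})\big),$$ $$y^{n+1}_{(i)}=\frac1{\phi_i^{n+1}}\sum_j a^n_{ij}\phi^n_j\,y^n_{(j)}+\frac1{\phi_i^{n+1}}\big(\nabla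 f_i(x^{n+1}_{(i)})-\nabla f_i(x^n_{(i)})\big).$$ **Step-size condition.** Put $L=\sum_iL_i$, $L_{\rm mx}=\max_iL_i$, $\tilde L_{\rm mx}=\max_i\tilde L_i+L_G$, $c_\tau=\min_i\tau_i$, $c_L=(L\sqrt I+L_{\rm mx}+\tilde L_{\rm mx})/I$, and let $\sigma\in(0,1)$ be arbitrary. Assume $$\alpha\le\min\left\{\frac{(1-\rho_{\bar B})\sigma}{\sqrt2\,c\,\bar B},\ \frac{2c_\tau\phi_{lb}}{I\phi_{ub}}\left(\frac{L+L_G}{I}+\frac{2c_L\bar Bc}{1-\rho_{\bar B}}\sqrt{\frac{2}{1-\sigma^2}}+\frac{12L_{\rm mx}\phi_{lb}^{-1}\bar B^2c^2}{(1-\rho_{\bar B})^2}\sqrt{\frac1{1-\sigma^2}}\right)^{-1}\right\}$$ (with $0^{-1}=+\infty$), where either 1. $I\ge2$, $c=I\sqrt{2I}$, $\phi_{lb}=\kappa^{2(I-1)B}$, $\phi_{ub}=I-\kappa^{2(I-1)B}$, $\tilde\kappa=\kappa^{2(I-1)B+1}/I$, $c_0=2(1+\tilde\kappa^{-(I-1)B})$,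 $\rho=1-\tilde\kappa^{(I-1)B}$, $\rho_{\bar B}=2c_0I\rho^{\lfloor\bar B/((I-1)B)\rfloor}$, and $\bar B\in\mathbb N$ is such that $\rho_{\bar B}<1$; or 2. all $A^n$ are doubly stochastic, $c=1$, $\bar B=B$, $\phi_{lb}=\phi_{ub}=1$, $\rho_{\bar B}=\sqrt{1-\kappa/(2I^2)}$. **Conclusion.** Let $\bar x^n=\frac1I\sum_ix^n_{(i)}$ and $M(x^n)=\max\{J(\bar x^n)^2,D(x^n)^2\}$, where $D(x^n)^2=\sum_i\|x^n_{(i)}-\bar x^n\|^2$ and $$J(\bar x)=\Big\|\bar x-\operatorname*{argmin}_{z\in K}\Big\{(\nabla F(\bar x)-\nabla G^-(\bar x))^\top(z-\bar x)+\tfrac12\|z-\bar x\|^2+G^+(z)\Big\}\Big\|.$$ Then $T_\varepsilon=\mathcal O(1/\varepsilon)$: there is a constant $C$, independent of $\varepsilon$, such that for every $\varepsilon>0$ the first iteration $T_\varepsilon=\min\{n\ge0: M(x^n)\le\varepsilon\}$ exists and satisfies $T_\varepsilon\le C/\varepsilon$. -/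

import Mathlib

open scoped NNReal

namespace Sonata

/-- The decision space `ℝ^m` with its Euclidean norm. -/
abbrev Vec (m : ℕ) := EuclideanSpace ℝ (Fin m)

/-- `p` is a minimizer of `g` over `K`. -/
def IsArgmin {m : ℕ} (K : Set (Vec m)) (g : Vec m → ℝ) (p : Vec m) : Prop :=
  p ∈ K ∧ IsMinOn g K p

/-- Data of the multiagent problem
`min_{x ∈ K} ∑ i, f i x + Gp x - Gm x`.
Functions are total; only their values on `O` (for `f`, `Gm`) and on `K` (for `Gp`) matter. -/
structure Problem (I m : ℕ) where
  /-- feasible set -/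
  K : Set (Vec m)
  /-- open set containing `K` on which the smooth functions live -/
  O : Set (Vec m)
  /-- the agents' costs -/
  f : Fin I → Vec m → ℝ
  /-- convex part of the regularizer -/
  Gp : Vec m → ℝ
  /-- smooth part, entering with a minus sign -/
  Gm : Vec m → ℝ

namespace Problem

variable {I m : ℕ}

/-- The objective `U = F + Gp - Gm`. -/
def U (P : Problem I m) (x : Vec m) : ℝ := (∑ i, P.f i x) + (P.Gp x - P.Gm x)

/-- Standing assumptions on the problem, with Lipschitz constants `L i` and `LG`. Lower
semicontinuity of `Gp` on `K` is what makes the minimizers below exist; it is automatic if `Gp`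
is the restriction of a finite convex function on the whole space. -/
structure Standing (P : Problem I m) (L : Fin I → ℝ≥0) (LG : ℝ≥0) : Prop where
  nonempty : P.K.Nonempty
  isClosed : IsClosed P.K
  convex : Convex ℝ P.K
  isOpen : IsOpen P.O
  subset : P.K ⊆ P.O
  f_contDiff : ∀ i, ContDiffOn ℝ 1 (P.f i) P.O
  f_lipschitz : ∀ i, LipschitzOnWith (L i) (gradient (P.f i)) P.K
  Gp_convex : ConvexOn ℝ P.K P.Gp
  Gp_lsc : LowerSemicontinuousOn P.Gp P.K
  Gm_contDiff : ContDiffOn ℝ 1 P.Gm P.O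
  Gm_lipschitz : LipschitzOnWith LG (gradient P.Gm) P.K
  U_bddBelow : BddBelow (P.U '' P.K)

/-- The function minimized over `K` in the definition of the stationarity measure at `z₀`. -/
noncomputable def stationarityModel (P : Problem I m) (z₀ z : Vec m) : ℝ :=
  inner ℝ ((∑ i, gradient (P.f i) z₀) - gradient P.Gm z₀) (z - z₀) + 1 / 2 * ‖z - z₀‖ ^ 2 + P.Gp z

/-- The minimizer of `stationarityModel z₀` over `K` (it exists and is unique for `z₀ ∈ K`). -/
noncomputable def stationarityPoint (P : Problem I m) (z₀ : Vec m) : Vec m :=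
  Classical.epsilon (fun p => IsArgmin P.K (P.stationarityModel z₀) p)

/-- Distance from stationarity `J`. -/
noncomputable def J (P : Problem I m) (z₀ : Vec m) : ℝ := ‖z₀ - P.stationarityPoint z₀‖

end Problem

section Metrics

variable {I m : ℕ}

/-- The average of the agents' copies. -/
noncomputable def avg (x : Fin I → Vec m) : Vec m := (1 / (I : ℝ)) • ∑ i, x i

/-- Consensus disagreement: the Euclidean norm of the stacked vector `(x i - avg x)_i`. -/
noncomputable def D (x : Fin I → Vec m) : ℝ := √(∑ i, ‖x i - avg x‖ ^ 2)

/-- The merit function `M = max (J², D²)`. -/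
noncomputable def M (P : Problem I m) (x : Fin I → Vec m) : ℝ := max (P.J (avg x) ^ 2) (D x ^ 2)

end Metrics

/-- Surrogate functions: `ft i x y` is the surrogate of `f i` at base point `y`, evaluated at `x`,
and `gft i x y` is its partial gradient with respect to `x` on `K`. -/
structure IsSurrogate {I m : ℕ} (P : Problem I m) (ft : Fin I → Vec m → Vec m → ℝ)
    (gft : Fin I → Vec m → Vec m → Vec m) (τ : Fin I → ℝ) (Lt : Fin I → ℝ≥0) : Prop where
  hasGradient : ∀ i, ∀ x ∈ P.K, ∀ y ∈ P.K,
    HasGradientWithinAt (fun z => ft i z y) (gft i x y) P.K x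
  gradient_continuous : ∀ i, ∀ y ∈ P.K, ContinuousOn (fun x => gft i x y) P.K
  gradient_diag : ∀ i, ∀ x ∈ P.K, gft i x x = gradient (P.f i) x
  τ_pos : ∀ i, 0 < τ i
  strongConvex : ∀ i, ∀ y ∈ P.K, StrongConvexOn P.K (τ i) (fun x => ft i x y)
  gradient_lipschitz : ∀ i, ∀ x ∈ P.K, LipschitzOnWith (Lt i) (fun y => gft i x y) P.K

/-- `B`-strong connectivity of a sequence of digraphs: the union of any `B` consecutive graphs is
strongly connected. `(G n).Adj j i` means that there is a link from `j` to `i` at time `n`. -/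
def IsBStronglyConnected {I : ℕ} (G : ℕ → Digraph (Fin I)) (B : ℕ) : Prop :=
  0 < B ∧ ∀ k : ℕ, ∀ u v : Fin I,
    Relation.ReflTransGen (fun a b => ∃ t, k ≤ t ∧ t < k + B ∧ (G t).Adj a b) u v

/-- The weight matrices are compliant with the digraphs, with uniform lower bound `κ`
(self-weights are always positive, whether or not the digraph has self-loops). -/
structure IsCompliant {I : ℕ} (G : ℕ → Digraph (Fin I)) (A : ℕ → Matrix (Fin I) (Fin I) ℝ)
    (κ : ℝ) : Prop where
  κ_pos : 0 < κ
  diag : ∀ n i, κ ≤ A n i i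
  edge : ∀ n i j, i ≠ j → (G n).Adj j i → κ ≤ A n i j
  not_edge : ∀ n i j, i ≠ j → ¬ (G n).Adj j i → A n i j = 0

/-- Column stochasticity of all the weight matrices. -/
def ColumnStochastic {I : ℕ} (A : ℕ → Matrix (Fin I) (Fin I) ℝ) : Prop :=
  ∀ n j, ∑ i, A n i j = 1

/-- Row stochasticity of all the weight matrices. -/
def RowStochastic {I : ℕ} (A : ℕ → Matrix (Fin I) (Fin I) ℝ) : Prop :=
  ∀ n i, ∑ j, A n i j = 1

/-- The convexified objective minimized by agent `i` at `x_(i) = xi`, `y_(i) = yi`. -/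
noncomputable def localModel {I m : ℕ} (P : Problem I m) (ft : Fin I → Vec m → Vec m → ℝ)
    (i : Fin I) (xi yi z : Vec m) : ℝ :=
  ft i z xi - inner ℝ (gradient P.Gm xi) (z - xi)
    + inner ℝ ((I : ℝ) • yi - gradient (P.f i) xi) (z - xi) + P.Gp z

/-- `(x, y, φ)`, with local solutions `xt`, is a sequence generated by SONATA with weight matrices
`A` and constant step-size `α`. -/
structure IsRun {I m : ℕ} (P : Problem I m) (ft : Fin I → Vec m → Vec m → ℝ)
    (A : ℕ → Matrix (Fin I) (Fin I) ℝ) (α : ℝ)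
    (x xt y : ℕ → Fin I → Vec m) (φ : ℕ → Fin I → ℝ) : Prop where
  x_zero : ∀ i, x 0 i ∈ P.K
  φ_zero : ∀ i, φ 0 i = 1
  y_zero : ∀ i, y 0 i = gradient (P.f i) (x 0 i)
  xt_argmin : ∀ n i, IsArgmin P.K (localModel P ft i (x n i) (y n i)) (xt n i)
  φ_succ : ∀ n i, φ (n + 1) i = ∑ j, A n i j * φ n j
  x_succ : ∀ n i, x (n + 1) i =
    (1 / φ (n + 1) i) • ∑ j, (A n i j * φ n j) • (x n j + α • (xt n j - x n j))
  y_succ : ∀ n i, y (n + 1) i =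
    (1 / φ (n + 1) i) • ∑ j, (A n i j * φ n j) • y n j
      + (1 / φ (n + 1) i) • (gradient (P.f i) (x (n + 1) i) - gradient (P.f i) (x n i))

section Constants

/-- `φ_lb = κ^{2(I-1)B}`. -/
def phiLb (I B : ℕ) (κ : ℝ) : ℝ := κ ^ (2 * (I - 1) * B)

/-- `φ_ub = I - κ^{2(I-1)B}`. -/
def phiUb (I B : ℕ) (κ : ℝ) : ℝ := I - κ ^ (2 * (I - 1) * B)

/-- `κ̃ = κ^{2(I-1)B+1} / I`. -/
noncomputable def kappaT (I B : ℕ) (κ : ℝ) : ℝ := κ ^ (2 * (I - 1) * B + 1) / I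

/-- `c₀ = 2 (1 + κ̃^{-(I-1)B})`. -/
noncomputable def c0 (I B : ℕ) (κ : ℝ) : ℝ := 2 * (1 + (kappaT I B κ ^ ((I - 1) * B))⁻¹)

/-- `ρ = 1 - κ̃^{(I-1)B}`. -/
noncomputable def rho (I B : ℕ) (κ : ℝ) : ℝ := 1 - kappaT I B κ ^ ((I - 1) * B)

/-- `ρ_{B̄} = 2 c₀ I ρ^{⌊B̄ / ((I-1)B)⌋}` (natural-number division is the floor). For `I = 1`, where
the formula is not meaningful, and for `B̄ = 0`, this value is larger than `1`. -/
noncomputable def rhoBar (I B : ℕ) (κ : ℝ) (Bbar : ℕ) : ℝ :=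
  2 * c0 I B κ * I * rho I B κ ^ (Bbar / ((I - 1) * B))

variable {I : ℕ}

/-- `c_τ = min_i τ_i`. -/
noncomputable def cTau (τ : Fin I → ℝ) : ℝ := ⨅ i, τ i

/-- `L = ∑_i L_i`. -/
def Lsum (L : Fin I → ℝ≥0) : ℝ := ∑ i, (L i : ℝ)

/-- `L_mx = max_i L_i`. -/
noncomputable def Lmx (L : Fin I → ℝ≥0) : ℝ := ⨆ i, (L i : ℝ)

/-- `c_L = (L √I + L_mx + L̃_mx) / I`, where `L̃_mx = max_i L̃_i + L_G`. -/
noncomputable def cL (L Lt : Fin I → ℝ≥0) (LG : ℝ≥0) : ℝ :=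
  (Lsum L * √(I : ℝ) + Lmx L + (Lmx Lt + LG)) / I

/-- The explicit step-size bound, as a function of the network parameters
`c`, `b` (`= B̄`), `lb` (`= φ_lb`), `ub` (`= φ_ub`), `r` (`= ρ_{B̄}`). The second inequality is
`α ≤ (2 c_τ lb / (I ub)) * (⋯)⁻¹` with the nonnegative factor `⋯` cleared, so that it imposes
no restriction when that factor is zero. -/
def StepBound (L Lt : Fin I → ℝ≥0) (LG : ℝ≥0) (τ : Fin I → ℝ) (σ c b lb ub r α : ℝ) : Prop :=
  α ≤ (1 - r) * σ / (√2 * c * b) ∧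
  α * ((Lsum L + LG) / I
      + 2 * cL L Lt LG * b * c / (1 - r) * √(2 / (1 - σ ^ 2))
      + 12 * Lmx L * lb⁻¹ * b ^ 2 * c ^ 2 / (1 - r) ^ 2 * √(1 / (1 - σ ^ 2)))
    ≤ 2 * cTau τ * lb / (I * ub)

/-- The condition on a constant step-size `α`: the bound holds with the network parameters of the
column-stochastic case, for some `B̄` with `ρ_{B̄} < 1`; or all the weight matrices are also row
stochastic and the bound holds with the parameters of the doubly stochastic case. -/
def FixedStep (A : ℕ → Matrix (Fin I) (Fin I) ℝ) (B : ℕ) (κ : ℝ)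
    (L Lt : Fin I → ℝ≥0) (LG : ℝ≥0) (τ : Fin I → ℝ) (σ α : ℝ) : Prop :=
  (∃ Bbar : ℕ, rhoBar I B κ Bbar < 1 ∧
    StepBound L Lt LG τ σ (I * √(2 * (I : ℝ))) Bbar (phiLb I B κ) (phiUb I B κ)
      (rhoBar I B κ Bbar) α) ∨
  (RowStochastic A ∧
    StepBound L Lt LG τ σ 1 B 1 1 (√(1 - κ / (2 * (I : ℝ) ^ 2))) α)

end Constants

end Sonata

/-!
The proof follows a Lyapunov function along the run. Write `mass n i = φ n i / I`, let `z n` be the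
`mass`-weighted average of the agents' copies, and let `δ n` be the Euclidean norm of the stacked
local directions `xt n - x n`. Column stochasticity preserves the weighted averages: `z` moves only
along the averaged directions, and the weighted average of the `y n i` is always the average of the
local gradients (`IsBoundedRun.sum_mass_smul_y`). By optimality of the local solutions and strong
convexity of the surrogates, `lyapunov` decreases by a multiple of `δ n ^ 2`, up to terms
(disagreement) `* δ n`, where the disagreement of the copies and of the trackers is measured
by `dev` (`IsBoundedRun.lyapunov_succ_le`).

The disagreements are controlled by the network. In the variables `x i` and `y i` the algorithm
averages with the row-stochastic matrices `ratioWeights`, which contract deviations over `b` steps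
(`IsMixing`). Hence the disagreements have finite `ℓ²` gain with respect to `δ`
(`l2_le_of_contracting_recursion`, a consequence of Minkowski's inequality in time), and the
step-size bound makes these gains small enough for the quadratic decrease to dominate
(`IsBoundedRun.exists_sum_M_le_of_isMixing`). Since the objective is bounded below, `δ` and both
disagreements are square summable. They control the merit function (`IsBoundedRun.M_le`, by
comparing two variational inequalities), so `M` is summable along the run, and a nonnegative
summable sequence falls below `ε` after at most `C / ε` steps.

Mixing is proved in two ways. For column-stochastic weights, the transition matrices over
`(I - 1) B` steps have all entries bounded below (`pow_le_transition`), so they contract the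
oscillation of columns. For doubly stochastic weights, the sum of squared deviations decreases in
every window of length `B` by at least `κ / 2` times the sum of the squared gaps between the sorted
initial values, each gap being charged to the first link that crosses it
(`half_mul_sum_gap_sq_le`); this yields the factor `1 - κ / (2 I²)`.
-/

namespace Sonata

open Finset

/-! ### Euclidean norms of finite families -/

section L2

variable {ι : Type*}

/-- The Euclidean norm of the finite family `(a i)_{i ∈ s}` of real numbers. It is used both for
families indexed by the agents and for initial segments of sequences in time. -/
noncomputable def l2 (s : Finset ι) (a : ι → ℝ) : ℝ := √(∑ i ∈ s, a i ^ 2)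

lemma l2_nonneg (s : Finset ι) (a : ι → ℝ) : 0 ≤ l2 s a := Real.sqrt_nonneg _

lemma l2_sq (s : Finset ι) (a : ι → ℝ) : l2 s a ^ 2 = ∑ i ∈ s, a i ^ 2 :=
  Real.sq_sqrt (sum_nonneg fun _ _ => sq_nonneg _)

lemma sum_mul_le_l2_mul_l2 (s : Finset ι) (a b : ι → ℝ) :
    ∑ i ∈ s, a i * b i ≤ l2 s a * l2 s b :=
  Real.sum_mul_le_sqrt_mul_sqrt s a b

lemma l2_add_le (s : Finset ι) (a b : ι → ℝ) :
    l2 s (fun i => a i + b i) ≤ l2 s a + l2 s b := by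
  refine Real.sqrt_le_iff.2 ⟨add_nonneg (l2_nonneg s a) (l2_nonneg s b), ?_⟩
  have h : ∑ i ∈ s, (a i + b i) ^ 2
      = ∑ i ∈ s, a i ^ 2 + 2 * ∑ i ∈ s, a i * b i + ∑ i ∈ s, b i ^ 2 := by
    rw [mul_sum, ← sum_add_distrib, ← sum_add_distrib]
    exact sum_congr rfl fun i _ => by ring
  rw [h, ← l2_sq, ← l2_sq]
  nlinarith [sum_mul_le_l2_mul_l2 s a b]

lemma l2_mono {s : Finset ι} {a b : ι → ℝ} (ha : ∀ i ∈ s, 0 ≤ a i) (hab : ∀ i ∈ s, a i ≤ b i) :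
    l2 s a ≤ l2 s b :=
  Real.sqrt_le_sqrt (sum_le_sum fun i hi => pow_le_pow_left₀ (ha i hi) (hab i hi) 2)

lemma l2_const_mul (s : Finset ι) {c : ℝ} (hc : 0 ≤ c) (a : ι → ℝ) :
    l2 s (fun i => c * a i) = c * l2 s a := by
  unfold l2
  simp_rw [mul_pow]
  rw [← mul_sum, Real.sqrt_mul (sq_nonneg c), Real.sqrt_sq hc]

lemma l2_mono_set {s t : Finset ι} (h : s ⊆ t) (a : ι → ℝ) : l2 s a ≤ l2 t a :=
  Real.sqrt_le_sqrt (sum_le_sum_of_subset_of_nonneg h fun _ _ _ => sq_nonneg _)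

lemma le_l2 {s : Finset ι} (a : ι → ℝ) {i : ι} (hi : i ∈ s) : a i ≤ l2 s a :=
  Real.le_sqrt_of_sq_le (single_le_sum (f := fun j => a j ^ 2) (fun _ _ => sq_nonneg _) hi)

lemma l2_sum_le {κ : Type*} (s : Finset ι) (t : Finset κ) (a : κ → ι → ℝ) :
    l2 s (fun i => ∑ k ∈ t, a k i) ≤ ∑ k ∈ t, l2 s (a k) := by
  classical
  induction t using Finset.induction_on with
  | empty => simp [l2]
  | insert k t hk ih =>
    simp_rw [sum_insert hk]
    exact (l2_add_le s _ _).trans (by gcongr)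

lemma sum_le_sqrt_card_mul_l2 (s : Finset ι) (a : ι → ℝ) :
    ∑ i ∈ s, a i ≤ √(#s : ℝ) * l2 s a := by
  have h := sum_mul_le_l2_mul_l2 s (fun _ => 1) a
  simpa [l2] using h

end L2

section Gain

lemma l2_range_shift_le (N b t : ℕ) (ht : t ≤ b) (d : ℕ → ℝ) :
    l2 (range (N - b)) (fun n => d (n + t)) ≤ l2 (range N) d := by
  refine Real.sqrt_le_sqrt ?_
  rw [← sum_image (s := range (N - b)) (g := fun n => n + t) (f := fun n => d n ^ 2)
    (fun x _ y _ h => by simpa using h)]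
  refine sum_le_sum_of_subset_of_nonneg (fun n hn => ?_) fun _ _ _ => sq_nonneg _
  simp only [mem_image, mem_range] at hn ⊢
  omega

lemma l2_range_split (N b : ℕ) (e : ℕ → ℝ) :
    l2 (range N) e ≤ l2 (range b) e + l2 (range (N - b)) (fun n => e (n + b)) := by
  refine Real.sqrt_le_iff.2 ⟨add_nonneg (l2_nonneg _ _) (l2_nonneg _ _), ?_⟩
  have h : ∑ n ∈ range N, e n ^ 2
      ≤ ∑ n ∈ range b, e n ^ 2 + ∑ n ∈ range (N - b), e (n + b) ^ 2 := by
    have h1 := sum_range_add (fun n => e n ^ 2) b (N - b)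
    simp_rw [add_comm b] at h1
    rw [← h1]
    exact sum_le_sum_of_subset_of_nonneg (range_mono (by omega)) fun _ _ _ => sq_nonneg _
  rw [← l2_sq (range b), ← l2_sq (range (N - b)) fun n => e (n + b)] at h
  nlinarith [mul_nonneg (l2_nonneg (range b) e) (l2_nonneg (range (N - b)) fun n => e (n + b))]

/-- A sequence that contracts by the factor `r` every `b` steps, up to an input `d` entering with
factor `c`, has `ℓ²` gain at most `c b / (1 - r)`. -/
lemma l2_le_of_contracting_recursion {e d : ℕ → ℝ} {r c : ℝ} {b : ℕ} (he : ∀ n, 0 ≤ e n)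
    (hr0 : 0 ≤ r) (hr1 : r < 1) (hc : 0 ≤ c)
    (h : ∀ n, e (n + b) ≤ r * e n + c * ∑ t ∈ range b, d (n + t)) (N : ℕ) :
    l2 (range N) e ≤ l2 (range b) e / (1 - r) + c * b / (1 - r) * l2 (range N) d := by
  have h1 : l2 (range (N - b)) (fun n => e (n + b))
      ≤ r * l2 (range N) e + c * (b * l2 (range N) d) := by
    refine (l2_mono (fun n _ => he _) fun n _ => h n).trans ((l2_add_le _ _ _).trans ?_)
    rw [l2_const_mul _ hr0, l2_const_mul _ hc]
    gcongr
    · exact l2_mono_set (range_mono (by omega)) _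
    · refine (l2_sum_le _ _ fun t n => d (n + t)).trans ?_
      refine (sum_le_sum fun t ht => l2_range_shift_le N b t (mem_range.1 ht).le d).trans ?_
      simp
  have h2 := l2_range_split N b e
  rw [div_mul_eq_mul_div, ← add_div, le_div_iff₀ (by linarith)]
  nlinarith

end Gain

/-! ### Averaging with time-varying matrices -/

section Averaging

variable {I m : ℕ}

/-- The Euclidean norm of the stacked vector `(v i)_i`. -/
noncomputable def stackNorm (v : Fin I → Vec m) : ℝ := l2 univ fun i => ‖v i‖

/-- The action of a matrix on a stacked vector. -/
noncomputable def act (M : Matrix (Fin I) (Fin I) ℝ) (v : Fin I → Vec m) : Fin I → Vec m :=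
  fun i => ∑ j, M i j • v j

/-- The deviation of a stacked vector from its average with weights `p`. -/
noncomputable def dev (p : Fin I → ℝ) (v : Fin I → Vec m) : Fin I → Vec m :=
  fun i => v i - ∑ j, p j • v j

/-- The transition matrix `W (n + k - 1) ⋯ W (n + 1) W n` over `k` steps from time `n`. -/
def transition (W : ℕ → Matrix (Fin I) (Fin I) ℝ) : ℕ → ℕ → Matrix (Fin I) (Fin I) ℝ
  | _, 0 => 1
  | n, k + 1 => transition W (n + 1) k * W n

lemma stackNorm_nonneg (v : Fin I → Vec m) : 0 ≤ stackNorm v := l2_nonneg _ _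

lemma stackNorm_sq (v : Fin I → Vec m) : stackNorm v ^ 2 = ∑ i, ‖v i‖ ^ 2 := l2_sq _ _

lemma norm_le_stackNorm (v : Fin I → Vec m) (i : Fin I) : ‖v i‖ ≤ stackNorm v :=
  le_l2 (fun i => ‖v i‖) (mem_univ i)

lemma stackNorm_add_le (v w : Fin I → Vec m) : stackNorm (v + w) ≤ stackNorm v + stackNorm w :=
  (l2_mono (fun _ _ => norm_nonneg _) fun i _ => norm_add_le (v i) (w i)).trans (l2_add_le _ _ _)

lemma stackNorm_neg (v : Fin I → Vec m) : stackNorm (-v) = stackNorm v := by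
  simp [stackNorm]

lemma stackNorm_sub_le (v w : Fin I → Vec m) : stackNorm (v - w) ≤ stackNorm v + stackNorm w := by
  rw [sub_eq_add_neg, ← stackNorm_neg w]
  exact stackNorm_add_le _ _

lemma stackNorm_smul {c : ℝ} (hc : 0 ≤ c) (v : Fin I → Vec m) :
    stackNorm (c • v) = c * stackNorm v := by
  simp [stackNorm, norm_smul, abs_of_nonneg hc, l2_const_mul _ hc]

lemma stackNorm_le_mul {c : ℝ} (hc : 0 ≤ c) {v w : Fin I → Vec m}
    (h : ∀ i, ‖v i‖ ≤ c * ‖w i‖) : stackNorm v ≤ c * stackNorm w := by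
  rw [stackNorm, stackNorm, ← l2_const_mul _ hc]
  exact l2_mono (fun _ _ => norm_nonneg _) fun i _ => h i

lemma act_add (M : Matrix (Fin I) (Fin I) ℝ) (v w : Fin I → Vec m) :
    act M (v + w) = act M v + act M w := by
  funext i; simp [act, smul_add, sum_add_distrib]

lemma act_sub (M : Matrix (Fin I) (Fin I) ℝ) (v w : Fin I → Vec m) :
    act M (v - w) = act M v - act M w := by
  funext i; simp [act, smul_sub, sum_sub_distrib]

lemma act_smul (M : Matrix (Fin I) (Fin I) ℝ) (c : ℝ) (v : Fin I → Vec m) :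
    act M (c • v) = c • act M v := by
  funext i; simp [act, smul_sum, smul_comm c]

lemma act_one (v : Fin I → Vec m) : act 1 v = v := by
  funext i; simp [act, Matrix.one_apply, ite_smul]

lemma act_mul (M N : Matrix (Fin I) (Fin I) ℝ) (v : Fin I → Vec m) :
    act (M * N) v = act M (act N v) := by
  funext i
  simp only [act, Matrix.mul_apply, sum_smul, smul_sum, mul_smul]
  exact sum_comm

lemma act_const {M : Matrix (Fin I) (Fin I) ℝ} (hM : ∀ i, ∑ j, M i j = 1) (a : Vec m) :
    act M (fun _ => a) = fun _ => a := by
  funext i; simp [act, ← sum_smul, hM]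

lemma dev_add (p : Fin I → ℝ) (v w : Fin I → Vec m) : dev p (v + w) = dev p v + dev p w := by
  funext i; simp only [dev, Pi.add_apply, smul_add, sum_add_distrib]; abel

lemma transition_succ (W : ℕ → Matrix (Fin I) (Fin I) ℝ) (n k : ℕ) :
    transition W n (k + 1) = W (n + k) * transition W n k := by
  induction k generalizing n with
  | zero => simp [transition]
  | succ k ih =>
    rw [transition, ih, transition, Matrix.mul_assoc]
    congr 2; omega

lemma transition_add (W : ℕ → Matrix (Fin I) (Fin I) ℝ) (n k l : ℕ) :
    transition W n (k + l) = transition W (n + k) l * transition W n k := by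
  induction l with
  | zero => simp [transition]
  | succ l ih => rw [← add_assoc, transition_succ, ih, transition_succ, Matrix.mul_assoc, add_assoc]

/-- Quantitative consensus for the averaging steps `v ↦ W n v`: relative to the averages with
weights `p n`, every `b` steps contract deviations by the factor `r`; the deviation after any number
of steps is at most `c` times the initial norm, and one step has norm at most `ω`. -/
structure IsMixing (m : ℕ) (W : ℕ → Matrix (Fin I) (Fin I) ℝ) (p : ℕ → Fin I → ℝ) (b : ℕ)
    (r c ω : ℝ) : Prop where
  contract : ∀ n (v : Fin I → Vec m),
    stackNorm (dev (p (n + b)) (act (transition W n b) v)) ≤ r * stackNorm (dev (p n) v)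
  bounded : ∀ n k (v : Fin I → Vec m),
    stackNorm (dev (p (n + k)) (act (transition W n k) v)) ≤ c * stackNorm v
  step : ∀ n (v : Fin I → Vec m), stackNorm (act (W n) v) ≤ ω * stackNorm v

namespace IsMixing

variable {W : ℕ → Matrix (Fin I) (Fin I) ℝ} {p : ℕ → Fin I → ℝ} {b : ℕ} {r c ω : ℝ}

lemma perturbation_le (h : IsMixing m W p b r c ω) {X u : ℕ → Fin I → Vec m}
    (hX : ∀ n, X (n + 1) = act (W n) (X n) + u n) (n k : ℕ) :
    stackNorm (dev (p (n + k)) (X (n + k) - act (transition W n k) (X n)))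
      ≤ c * ∑ t ∈ range k, stackNorm (u (n + t)) := by
  induction k generalizing n with
  | zero =>
    have h0 : dev (p n) (0 : Fin I → Vec m) = 0 := by funext i; simp [dev]
    simp [transition, act_one, h0, stackNorm, l2]
  | succ k ih =>
    have e : X (n + (k + 1)) - act (transition W n (k + 1)) (X n)
        = (X (n + 1 + k) - act (transition W (n + 1) k) (X (n + 1)))
          + act (transition W (n + 1) k) (u n) := by
      rw [transition, act_mul, hX n, act_add, show n + (k + 1) = n + 1 + k by omega]
      abel
    have e2 : n + (k + 1) = n + 1 + k := by omega
    rw [e, dev_add, sum_range_succ', mul_add, e2]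
    refine (stackNorm_add_le _ _).trans (add_le_add ?_ (h.bounded (n + 1) k (u n)))
    refine (ih (n + 1)).trans_eq ?_
    simp_rw [add_assoc, add_comm 1]

/-- The deviations of a perturbed averaging recursion have `ℓ²` gain at most `c b / (1 - r)` with
respect to the perturbations. -/
lemma l2_dev_le (h : IsMixing m W p b r c ω) (hr0 : 0 ≤ r) (hr1 : r < 1) (hc : 0 ≤ c)
    {X u : ℕ → Fin I → Vec m} (hX : ∀ n, X (n + 1) = act (W n) (X n) + u n) (N : ℕ) :
    l2 (range N) (fun n => stackNorm (dev (p n) (X n)))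
      ≤ l2 (range b) (fun n => stackNorm (dev (p n) (X n))) / (1 - r)
        + c * b / (1 - r) * l2 (range N) (fun n => stackNorm (u n)) := by
  refine l2_le_of_contracting_recursion (fun n => stackNorm_nonneg _) hr0 hr1 hc (fun n => ?_) N
  have e : X (n + b) = act (transition W n b) (X n)
      + (X (n + b) - act (transition W n b) (X n)) := by abel
  calc stackNorm (dev (p (n + b)) (X (n + b)))
      ≤ stackNorm (dev (p (n + b)) (act (transition W n b) (X n)))
        + stackNorm (dev (p (n + b)) (X (n + b) - act (transition W n b) (X n))) := by
        conv_lhs => rw [e, dev_add]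
        exact stackNorm_add_le _ _
    _ ≤ _ := add_le_add (h.contract n _) (h.perturbation_le hX n b)

end IsMixing

end Averaging

/-! ### Products of compliant matrices -/

section Products

variable {I : ℕ} {G : ℕ → Digraph (Fin I)} {B : ℕ} {A : ℕ → Matrix (Fin I) (Fin I) ℝ} {κ : ℝ}

lemma exists_rel_mem_notMem {α : Type*} {r : α → α → Prop} {S : Set α} {u v : α}
    (h : Relation.ReflTransGen r u v) (hu : u ∈ S) (hv : v ∉ S) :
    ∃ a b, r a b ∧ a ∈ S ∧ b ∉ S := by
  induction h with
  | refl => exact absurd hu hv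
  | @tail b c _ hbc ih =>
    by_cases hb : b ∈ S
    · exact ⟨b, c, hbc, hb, hv⟩
    · exact ih hb

/-- Every nontrivial cut is crossed by a link in every time window of length `B`. -/
lemma IsBStronglyConnected.exists_crossing (hG : IsBStronglyConnected G B) (k : ℕ)
    {S : Set (Fin I)} {u v : Fin I} (hu : u ∈ S) (hv : v ∉ S) :
    ∃ s < B, ∃ a ∈ S, ∃ b ∉ S, (G (k + s)).Adj a b := by
  obtain ⟨a, b, ⟨t, h1, h2, h3⟩, ha, hb⟩ := exists_rel_mem_notMem (hG.2 k u v) hu hv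
  refine ⟨t - k, by omega, a, ha, b, hb, ?_⟩
  rwa [Nat.add_sub_cancel' h1]

lemma IsCompliant.nonneg (hA : IsCompliant G A κ) (n : ℕ) (i j : Fin I) : 0 ≤ A n i j := by
  by_cases hij : i = j
  · subst hij; exact hA.κ_pos.le.trans (hA.diag n i)
  · by_cases h : (G n).Adj j i
    · exact hA.κ_pos.le.trans (hA.edge n i j hij h)
    · exact (hA.not_edge n i j hij h).ge

lemma IsCompliant.le_of_adj (hA : IsCompliant G A κ) {n : ℕ} {i j : Fin I} (h : (G n).Adj j i) :
    κ ≤ A n i j := by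
  by_cases hij : i = j
  · subst hij; exact hA.diag n i
  · exact hA.edge n i j hij h

lemma transition_nonneg (hA : ∀ n i j, 0 ≤ A n i j) (n k : ℕ) (i j : Fin I) :
    0 ≤ transition A n k i j := by
  induction k generalizing i with
  | zero => simp only [transition, Matrix.one_apply]; split_ifs <;> norm_num
  | succ k ih =>
    rw [transition_succ, Matrix.mul_apply]
    exact sum_nonneg fun l _ => mul_nonneg (hA _ _ _) (ih _)

lemma transition_row_sum (hA : ∀ n i, ∑ j, A n i j = 1) (n k : ℕ) (i : Fin I) :
    ∑ j, transition A n k i j = 1 := by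
  induction k generalizing i with
  | zero => simp [transition, Matrix.one_apply]
  | succ k ih =>
    rw [transition_succ]
    simp_rw [Matrix.mul_apply]
    rw [sum_comm]
    simp_rw [← mul_sum, ih, mul_one, hA]

/-- Weights `p n` that are preserved by every step are preserved by the transition matrices. -/
lemma sum_mul_transition {p : ℕ → Fin I → ℝ} (hp : ∀ n j, ∑ i, p (n + 1) i * A n i j = p n j)
    (n k : ℕ) (j : Fin I) : ∑ i, p (n + k) i * transition A n k i j = p n j := by
  induction k generalizing j with
  | zero => simp [transition, Matrix.one_apply]
  | succ k ih =>
    rw [transition_succ]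
    simp_rw [Matrix.mul_apply, mul_sum, ← mul_assoc]
    rw [sum_comm]
    simp_rw [← sum_mul, ← add_assoc, hp]
    exact ih j

/-- After `I - 1` windows of length `B`, every entry of the transition matrix is positive: in each
window the set of agents reached from `j` gains an element until it is everything. -/
lemma pow_le_transition (hG : IsBStronglyConnected G B) (hA : IsCompliant G A κ) (n : ℕ)
    (i j : Fin I) : κ ^ ((I - 1) * B) ≤ transition A n ((I - 1) * B) i j := by
  classical
  set R : ℕ → Finset (Fin I) := fun k => univ.filter fun l => κ ^ k ≤ transition A n k l j with hR
  have memR : ∀ k l, l ∈ R k ↔ κ ^ k ≤ transition A n k l j := by simp [hR]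
  have hstep : ∀ k a b, a ∈ R k → κ ≤ A (n + k) b a → b ∈ R (k + 1) := by
    intro k a b ha hab
    rw [memR] at ha ⊢
    rw [transition_succ, Matrix.mul_apply, pow_succ']
    calc κ * κ ^ k ≤ A (n + k) b a * transition A n k a j :=
          mul_le_mul hab ha (pow_nonneg hA.κ_pos.le _) (hA.nonneg _ _ _)
      _ ≤ _ := single_le_sum (f := fun l => A (n + k) b l * transition A n k l j)
          (fun l _ => mul_nonneg (hA.nonneg _ _ _) (transition_nonneg hA.nonneg _ _ _ _))
          (mem_univ a)
  have hmono : Monotone R :=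
    monotone_nat_of_le_succ fun k a ha => hstep k a a ha (hA.diag _ _)
  have hcard : ∀ s, min I (s + 1) ≤ #(R (s * B)) := by
    intro s
    induction s with
    | zero =>
      have : j ∈ R (0 * B) := by rw [memR]; simp [transition]
      have := card_pos.2 ⟨j, this⟩
      omega
    | succ s ih =>
      by_cases hall : R (s * B) = univ
      · have h1 : R ((s + 1) * B) = univ :=
          univ_subset_iff.1 (hall ▸ hmono (Nat.mul_le_mul_right B s.le_succ))
        rw [h1, card_fin]
        exact min_le_left _ _
      · obtain ⟨v, hv⟩ : ∃ v, v ∉ R (s * B) := by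
          by_contra! h
          exact hall (eq_univ_iff_forall.2 h)
        have hjR : j ∈ R (s * B) := hmono (Nat.zero_le _) (by rw [memR]; simp [transition])
        obtain ⟨t, htB, a, ha, b, hb, hab⟩ :=
          hG.exists_crossing (n + s * B) (S := (R (s * B) : Set (Fin I)))
            (mem_coe.2 hjR) (fun h => hv (mem_coe.1 h))
        have hb' : b ∈ R ((s + 1) * B) := by
          have ha' : a ∈ R (s * B + t) := hmono (Nat.le_add_right _ _) (mem_coe.1 ha)
          refine hmono ?_ (hstep _ a b ha' (hA.le_of_adj (by rwa [← add_assoc])))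
          rw [add_mul, one_mul]; omega
        have hlt : #(R (s * B)) < #(R ((s + 1) * B)) := by
          refine card_lt_card ((ssubset_iff_of_subset
            (hmono (Nat.mul_le_mul_right B s.le_succ))).2 ⟨b, hb', ?_⟩)
          exact fun h => hb (mem_coe.2 h)
        omega
  have hI : 0 < I := i.pos
  have h := hcard (I - 1)
  have huniv : R ((I - 1) * B) = univ := by
    refine eq_univ_of_card _ (le_antisymm (card_le_univ _) ?_)
    rw [Fintype.card_fin]
    omega
  exact (memR _ _).1 (huniv ▸ mem_univ i)

end Products

/-! ### Mixing of column-stochastic weights -/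

section ColumnStochasticMixing

variable {I m : ℕ}

/-- All the entries of `v` lie in an interval of length `d`. -/
def OscLE (v : Fin I → ℝ) (d : ℝ) : Prop := ∃ a, ∀ i, v i ∈ Set.Icc a (a + d)

lemma sum_mul_mem_Icc {w v : Fin I → ℝ} (hw : ∀ j, 0 ≤ w j) {a c : ℝ}
    (h : ∀ j, v j ∈ Set.Icc a c) :
    ∑ j, w j * v j ∈ Set.Icc ((∑ j, w j) * a) ((∑ j, w j) * c) := by
  rw [sum_mul, sum_mul]
  exact ⟨sum_le_sum fun j _ => mul_le_mul_of_nonneg_left (h j).1 (hw j),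
    sum_le_sum fun j _ => mul_le_mul_of_nonneg_left (h j).2 (hw j)⟩

/-- A row-stochastic matrix with a column bounded below by `η` contracts oscillations by
`1 - η`. -/
lemma OscLE.mulVec {M : Matrix (Fin I) (Fin I) ℝ} {η : ℝ} {j₀ : Fin I} (hM0 : ∀ i j, 0 ≤ M i j)
    (hη : ∀ i, η ≤ M i j₀) (hM : ∀ i, ∑ j, M i j = 1) {v : Fin I → ℝ} {d : ℝ} (hv : OscLE v d) :
    OscLE (fun i => ∑ j, M i j * v j) ((1 - η) * d) := by
  obtain ⟨a, ha⟩ := hv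
  refine ⟨η * v j₀ + (1 - η) * a, fun i => ?_⟩
  have hw : ∀ j, 0 ≤ M i j - if j = j₀ then η else 0 := fun j => by
    split_ifs with h
    · subst h; exact sub_nonneg.2 (hη i)
    · simpa using hM0 i j
  have h := sum_mul_mem_Icc hw ha
  simp only [sub_mul, sum_sub_distrib, hM, ite_mul, zero_mul, sum_ite_eq', mem_univ,
    if_true] at h
  constructor <;> linarith [h.1, h.2]

lemma OscLE.mulVec_le {M : Matrix (Fin I) (Fin I) ℝ} (hM0 : ∀ i j, 0 ≤ M i j)
    (hM : ∀ i, ∑ j, M i j = 1) {v : Fin I → ℝ} {d : ℝ} (hv : OscLE v d) :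
    OscLE (fun i => ∑ j, M i j * v j) d := by
  obtain ⟨a, ha⟩ := hv
  refine ⟨a, fun i => ?_⟩
  simpa [hM] using sum_mul_mem_Icc (hM0 i) ha

/-- If the transition matrices over `T` steps have entries at least `η`, the columns of the
transition matrix over at least `q T` steps oscillate by at most `(1 - η) ^ q`. -/
lemma oscLE_transition {W : ℕ → Matrix (Fin I) (Fin I) ℝ} (hW0 : ∀ n i j, 0 ≤ W n i j)
    (hW : ∀ n i, ∑ j, W n i j = 1) {T : ℕ} {η : ℝ} (hη : ∀ n i j, η ≤ transition W n T i j)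
    (n q s : ℕ) (j : Fin I) :
    OscLE (fun i => transition W n (T * q + s) i j) ((1 - η) ^ q) := by
  have key : ∀ q, OscLE (fun i => transition W n (T * q) i j) ((1 - η) ^ q) := by
    intro q
    induction q with
    | zero =>
      refine ⟨0, fun i => ?_⟩
      simp only [mul_zero, transition, Matrix.one_apply, pow_zero, Set.mem_Icc]
      split_ifs <;> norm_num
    | succ q ih =>
      rw [mul_add, mul_one, pow_succ']
      simp_rw [transition_add, Matrix.mul_apply]
      exact ih.mulVec (j₀ := j) (transition_nonneg hW0 _ _) (fun i => hη _ i j)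
        (transition_row_sum hW _ _)
  simp_rw [transition_add W n (T * q) s, Matrix.mul_apply]
  exact (key q).mulVec_le (transition_nonneg hW0 _ _) (transition_row_sum hW _ _)

/-- The operator norm of a matrix on stacked vectors is at most its Frobenius norm. -/
lemma stackNorm_act_le {M : Matrix (Fin I) (Fin I) ℝ} {F : ℝ} (hF : 0 ≤ F)
    (hM : ∑ i, ∑ j, M i j ^ 2 ≤ F ^ 2) (v : Fin I → Vec m) :
    stackNorm (act M v) ≤ F * stackNorm v := by
  refine Real.sqrt_le_iff.2 ⟨mul_nonneg hF (stackNorm_nonneg v), ?_⟩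
  rw [mul_pow]
  refine le_trans ?_ (mul_le_mul_of_nonneg_right hM (sq_nonneg _))
  rw [sum_mul]
  refine sum_le_sum fun i _ => ?_
  have h1 : ‖act M v i‖ ≤ l2 univ (M i) * stackNorm v := by
    refine (norm_sum_le _ _).trans ?_
    simp_rw [norm_smul]
    refine (sum_mul_le_l2_mul_l2 _ _ _).trans_eq ?_
    simp [l2, stackNorm]
  refine (pow_le_pow_left₀ (norm_nonneg _) h1 2).trans_eq ?_
  rw [mul_pow, l2_sq]

/-- Deviations after a step that maps the weights `p'` to `p`. -/
lemma dev_act {M : Matrix (Fin I) (Fin I) ℝ} {p p' : Fin I → ℝ}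
    (h : ∀ j, ∑ i, p' i * M i j = p j) (v : Fin I → Vec m) :
    dev p' (act M v) = act (Matrix.of fun i j => M i j - p j) v := by
  funext i
  have : ∑ k, p' k • ∑ j, M k j • v j = ∑ j, p j • v j := by
    simp_rw [smul_sum, smul_smul]
    rw [sum_comm]
    simp_rw [← sum_smul, h]
  simp only [dev, act, this, Matrix.of_apply, sub_smul, sum_sub_distrib]

lemma act_sub_const_dev {M : Matrix (Fin I) (Fin I) ℝ} {p q : Fin I → ℝ}
    (hM : ∀ i, ∑ j, M i j = 1) (hp : ∑ j, p j = 1) (v : Fin I → Vec m) :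
    act (Matrix.of fun i j => M i j - p j) (dev q v)
      = act (Matrix.of fun i j => M i j - p j) v := by
  have : dev q v = v - fun _ => ∑ j, q j • v j := rfl
  rw [this, act_sub, sub_eq_self]
  funext i
  simp [act, ← sum_smul, hM, hp]

lemma sum_sq_le_one {w : Fin I → ℝ} (h0 : ∀ j, 0 ≤ w j) (h1 : ∑ j, w j = 1) :
    ∑ j, w j ^ 2 ≤ 1 := by
  refine (sum_le_sum fun j _ => ?_).trans_eq h1
  have : w j ≤ 1 := h1 ▸ single_le_sum (fun k _ => h0 k) (mem_univ j)
  nlinarith [h0 j]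

/-- Row-stochastic steps with positive transition matrices over `T` steps are mixing. -/
lemma isMixing_of_le_transition {W : ℕ → Matrix (Fin I) (Fin I) ℝ} {p : ℕ → Fin I → ℝ}
    (hW0 : ∀ n i j, 0 ≤ W n i j) (hW : ∀ n i, ∑ j, W n i j = 1) (hp0 : ∀ n i, 0 ≤ p n i)
    (hp1 : ∀ n, ∑ i, p n i = 1) (hp : ∀ n j, ∑ i, p (n + 1) i * W n i j = p n j)
    {T : ℕ} {η : ℝ} (hη1 : η ≤ 1) (hη : ∀ n i j, η ≤ transition W n T i j) (b : ℕ) :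
    IsMixing m W p b (I * (1 - η) ^ (b / T)) (√(2 * I)) (√I) where
  contract n v := by
    rw [dev_act (sum_mul_transition hp n b), ← act_sub_const_dev (transition_row_sum hW n b) (hp1 n)
      (q := p n)]
    refine stackNorm_act_le (mul_nonneg (Nat.cast_nonneg _) (pow_nonneg (by linarith) _)) ?_ _
    have hent : ∀ i j, (transition W n b i j - p n j) ^ 2 ≤ ((1 - η) ^ (b / T)) ^ 2 := by
      intro i j
      obtain ⟨a, ha⟩ := oscLE_transition hW0 hW hη n (b / T) (b % T) j
      rw [Nat.div_add_mod] at ha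
      have h1 := sum_mul_mem_Icc (hp0 (n + b)) ha
      rw [hp1, sum_mul_transition hp n b, one_mul, one_mul] at h1
      refine sq_le_sq' ?_ ?_ <;> linarith [(ha i).1, (ha i).2, h1.1, h1.2]
    refine (sum_le_sum fun i _ => sum_le_sum fun j _ => hent i j).trans_eq ?_
    simp; ring
  bounded n k v := by
    rw [dev_act (sum_mul_transition hp n k)]
    refine stackNorm_act_le (Real.sqrt_nonneg _) ?_ _
    rw [Real.sq_sqrt (by positivity)]
    have hrow : ∀ i, ∑ j, (transition W n k i j - p n j) ^ 2 ≤ 2 := by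
      intro i
      have h1 := sum_sq_le_one (transition_nonneg hW0 n k i) (transition_row_sum hW n k i)
      have h2 := sum_sq_le_one (hp0 n) (hp1 n)
      have h3 : ∑ j, (transition W n k i j - p n j) ^ 2
          ≤ ∑ j, (transition W n k i j ^ 2 + p n j ^ 2) := by
        refine sum_le_sum fun j _ => ?_
        nlinarith [mul_nonneg (transition_nonneg hW0 n k i j) (hp0 n j)]
      rw [sum_add_distrib] at h3
      linarith
    refine (sum_le_sum fun i _ => hrow i).trans_eq ?_
    simp; ring
  step n v := by
    refine stackNorm_act_le (Real.sqrt_nonneg _) ?_ _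
    rw [Real.sq_sqrt (by positivity)]
    refine (sum_le_sum fun i _ => sum_sq_le_one (hW0 n i) (hW n i)).trans_eq ?_
    simp

/-- The row-stochastic matrix with which the ratios `x i` of `φ`-weighted sums are updated. -/
noncomputable def ratioWeights (A : ℕ → Matrix (Fin I) (Fin I) ℝ) (φ : ℕ → Fin I → ℝ) (n : ℕ) :
    Matrix (Fin I) (Fin I) ℝ :=
  Matrix.of fun i j => A n i j * φ n j / φ (n + 1) i

variable {A : ℕ → Matrix (Fin I) (Fin I) ℝ} {φ : ℕ → Fin I → ℝ}

lemma ratioWeights_row_sum (hφ : ∀ n i, 0 < φ n i)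
    (hs : ∀ n i, φ (n + 1) i = ∑ j, A n i j * φ n j) (n : ℕ) (i : Fin I) :
    ∑ j, ratioWeights A φ n i j = 1 := by
  simp only [ratioWeights, Matrix.of_apply]
  rw [← sum_div, ← hs, div_self (hφ _ _).ne']

lemma sum_div_mul_ratioWeights (hcol : ColumnStochastic A) (hφ : ∀ n i, 0 < φ n i) (n : ℕ)
    (j : Fin I) : ∑ i, φ (n + 1) i / I * ratioWeights A φ n i j = φ n j / I := by
  have : ∀ i, φ (n + 1) i / I * ratioWeights A φ n i j = A n i j * (φ n j / I) := fun i => by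
    simp only [ratioWeights, Matrix.of_apply]
    field_simp [(hφ (n + 1) i).ne']
  simp_rw [this, ← sum_mul, hcol n j, one_mul]

lemma sum_phi (hcol : ColumnStochastic A) (h0 : ∀ i, φ 0 i = 1)
    (hs : ∀ n i, φ (n + 1) i = ∑ j, A n i j * φ n j) (n : ℕ) : ∑ i, φ n i = I := by
  induction n with
  | zero => simp [h0]
  | succ n ih =>
    simp_rw [hs]
    rw [sum_comm]
    simp_rw [← sum_mul, hcol n, one_mul, ih]

variable {G : ℕ → Digraph (Fin I)} {B : ℕ} {κ : ℝ}

lemma IsCompliant.le_one (hA : IsCompliant G A κ) (hcol : ColumnStochastic A) (hI : 1 ≤ I) :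
    κ ≤ 1 := by
  have i : Fin I := ⟨0, hI⟩
  refine (hA.diag 0 i).trans ?_
  rw [← hcol 0 i]
  exact single_le_sum (f := fun k => A 0 k i) (fun k _ => hA.nonneg _ _ _) (mem_univ i)

lemma phi_eq_transition (hs : ∀ n i, φ (n + 1) i = ∑ j, A n i j * φ n j) (n k : ℕ) (i : Fin I) :
    φ (n + k) i = ∑ j, transition A n k i j * φ n j := by
  induction k generalizing i with
  | zero => simp [transition, Matrix.one_apply]
  | succ k ih =>
    rw [transition_succ, ← add_assoc, hs]
    simp_rw [ih, Matrix.mul_apply, mul_sum, sum_mul, mul_assoc]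
    exact sum_comm

lemma phiLb_pos (hκ : 0 < κ) : 0 < phiLb I B κ := pow_pos hκ _

/-- Up to time `(I - 1) B` the self-weights keep `φ` large; later, every agent receives a
share of the total mass. -/
lemma phiLb_le_phi (hG : IsBStronglyConnected G B) (hA : IsCompliant G A κ)
    (hcol : ColumnStochastic A) (hI : 1 ≤ I) (h0 : ∀ i, φ 0 i = 1)
    (hs : ∀ n i, φ (n + 1) i = ∑ j, A n i j * φ n j) (n : ℕ) (i : Fin I) :
    phiLb I B κ ≤ φ n i := by
  have hκ := hA.κ_pos
  have hκ1 := hA.le_one hcol hI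
  have hnn : ∀ n i, 0 ≤ φ n i := by
    intro n
    induction n with
    | zero => simp [h0]
    | succ n ih => exact fun i => hs n i ▸ sum_nonneg fun j _ => mul_nonneg (hA.nonneg _ _ _) (ih j)
  set T := (I - 1) * B with hT
  have hlb : phiLb I B κ = κ ^ (2 * T) := by rw [phiLb, hT, mul_assoc]
  rw [hlb]
  rcases le_total n T with h | h
  · have hpow : ∀ n, κ ^ n ≤ φ n i := by
      intro n
      induction n with
      | zero => simp [h0]
      | succ n ih =>
        rw [hs, pow_succ']
        calc κ * κ ^ n ≤ A n i i * φ n i := mul_le_mul (hA.diag n i) ih (by positivity)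
              (hA.nonneg _ _ _)
          _ ≤ _ := single_le_sum (f := fun j => A n i j * φ n j)
              (fun j _ => mul_nonneg (hA.nonneg _ _ _) (hnn n j)) (mem_univ i)
    exact (pow_le_pow_of_le_one hκ.le hκ1 (by omega)).trans (hpow n)
  · obtain ⟨k, rfl⟩ := Nat.exists_eq_add_of_le' h
    rw [phi_eq_transition hs]
    calc κ ^ (2 * T) ≤ κ ^ T * 1 := by
          rw [mul_one]; exact pow_le_pow_of_le_one hκ.le hκ1 (by omega)
      _ ≤ κ ^ T * I := by gcongr; exact_mod_cast hI
      _ = ∑ j, κ ^ T * φ k j := by rw [← mul_sum, sum_phi hcol h0 hs]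
      _ ≤ _ := sum_le_sum fun j _ =>
          mul_le_mul_of_nonneg_right (pow_le_transition hG hA k i j) (hnn k j)

lemma phi_le_phiUb (hG : IsBStronglyConnected G B) (hA : IsCompliant G A κ)
    (hcol : ColumnStochastic A) (hI : 2 ≤ I) (h0 : ∀ i, φ 0 i = 1)
    (hs : ∀ n i, φ (n + 1) i = ∑ j, A n i j * φ n j) (n : ℕ) (i : Fin I) :
    φ n i ≤ phiUb I B κ := by
  have hlb := phiLb_le_phi hG hA hcol (by omega) h0 hs n
  have : Nontrivial (Fin I) := Fin.nontrivial_iff_two_le.2 hI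
  obtain ⟨k, hk⟩ := exists_ne i
  have hle : φ n i + φ n k ≤ ∑ j, φ n j := by
    rw [← sum_pair hk.symm]
    exact sum_le_sum_of_subset_of_nonneg (subset_univ _)
      fun j _ _ => (phiLb_pos hA.κ_pos).le.trans (hlb j)
  rw [sum_phi hcol h0 hs] at hle
  have := hlb k
  rw [phiLb] at this
  rw [phiUb]
  linarith

/-- The ratio weights are compliant with the same digraphs, with lower bound `kappaT`. -/
lemma isCompliant_ratioWeights (hG : IsBStronglyConnected G B) (hA : IsCompliant G A κ)
    (hcol : ColumnStochastic A) (hI : 1 ≤ I) (h0 : ∀ i, φ 0 i = 1)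
    (hs : ∀ n i, φ (n + 1) i = ∑ j, A n i j * φ n j) :
    IsCompliant G (ratioWeights A φ) (kappaT I B κ) := by
  have hlb := phiLb_le_phi hG hA hcol hI h0 hs
  have hpos : ∀ n i, 0 < φ n i := fun n i => (phiLb_pos hA.κ_pos).trans_le (hlb n i)
  have hub : ∀ n i, φ n i ≤ I := fun n i =>
    sum_phi hcol h0 hs n ▸ single_le_sum (fun k _ => (hpos n k).le) (mem_univ i)
  have hkey : ∀ n i j, κ ≤ A n i j → kappaT I B κ ≤ ratioWeights A φ n i j := by
    intro n i j h
    simp only [ratioWeights, Matrix.of_apply, kappaT, pow_succ']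
    exact div_le_div₀ (mul_nonneg (hA.nonneg _ _ _) (hpos n j).le)
      (mul_le_mul h (hlb n j) (phiLb_pos hA.κ_pos).le (hA.nonneg _ _ _)) (hpos _ _) (hub _ _)
  refine ⟨div_pos (pow_pos hA.κ_pos _) (by exact_mod_cast hI), fun n i => hkey n i i (hA.diag n i),
    fun n i j hij h => hkey n i j (hA.edge n i j hij h), fun n i j hij h => ?_⟩
  simp [ratioWeights, hA.not_edge n i j hij h]

lemma kappaT_le_one (hκ : 0 < κ) (hκ1 : κ ≤ 1) (hI : 1 ≤ I) : kappaT I B κ ≤ 1 := by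
  have : (1 : ℝ) ≤ I := by exact_mod_cast hI
  exact div_le_one_of_le₀ ((pow_le_one₀ hκ.le hκ1).trans this) (by linarith)

lemma isMixing_ratioWeights (hG : IsBStronglyConnected G B) (hA : IsCompliant G A κ)
    (hcol : ColumnStochastic A) (hI : 1 ≤ I) (h0 : ∀ i, φ 0 i = 1)
    (hs : ∀ n i, φ (n + 1) i = ∑ j, A n i j * φ n j) (b : ℕ) :
    IsMixing m (ratioWeights A φ) (fun n i => φ n i / I) b (rhoBar I B κ b) (√(2 * I)) (√I) := by
  have hI0 : (0 : ℝ) < I := by exact_mod_cast hI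
  have hκ1 := hA.le_one hcol hI
  have hW := isCompliant_ratioWeights hG hA hcol hI h0 hs
  have hpos : ∀ n i, 0 < φ n i := fun n i =>
    (phiLb_pos hA.κ_pos).trans_le (phiLb_le_phi hG hA hcol hI h0 hs n i)
  have hη1 : kappaT I B κ ^ ((I - 1) * B) ≤ 1 :=
    pow_le_one₀ hW.κ_pos.le (kappaT_le_one hA.κ_pos hκ1 hI)
  have h := isMixing_of_le_transition (m := m) hW.nonneg (ratioWeights_row_sum hpos hs)
    (p := fun n i => φ n i / I) (fun n i => (div_pos (hpos n i) hI0).le)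
    (fun n => by rw [← sum_div, sum_phi hcol h0 hs, div_self hI0.ne'])
    (sum_div_mul_ratioWeights hcol hpos) hη1 (pow_le_transition hG hW) b
  refine ⟨fun n v => (h.contract n v).trans ?_, h.bounded, h.step⟩
  refine mul_le_mul_of_nonneg_right ?_ (stackNorm_nonneg _)
  have hρ : 0 ≤ rho I B κ ^ (b / ((I - 1) * B)) := pow_nonneg (by rw [rho]; linarith) _
  have hc : 1 ≤ 2 * c0 I B κ := by
    have : 0 < (kappaT I B κ ^ ((I - 1) * B))⁻¹ := inv_pos.2 (pow_pos hW.κ_pos _)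
    rw [c0]; linarith
  rw [rhoBar]
  change I * rho I B κ ^ (b / ((I - 1) * B)) ≤ _
  nlinarith [mul_nonneg hI0.le hρ]

end ColumnStochasticMixing

/-! ### Mixing of doubly stochastic weights -/

section DoublyStochasticMixing

variable {I m : ℕ}

/-- The variance of `f` under the probability weights `w`. -/
def wVar (w f : Fin I → ℝ) : ℝ := ∑ i, w i * f i ^ 2 - (∑ i, w i * f i) ^ 2

lemma wVar_eq {w : Fin I → ℝ} (hw : ∑ i, w i = 1) (f : Fin I → ℝ) :
    wVar w f = 1 / 2 * ∑ i, ∑ j, w i * w j * (f i - f j) ^ 2 := by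
  have h : ∀ i, ∑ j, w i * w j * (f i - f j) ^ 2 = w i * f i ^ 2 * ∑ j, w j
      - w i * f i * (2 * ∑ j, w j * f j) + w i * ∑ j, w j * f j ^ 2 := fun i => by
    simp_rw [mul_sum, ← sum_sub_distrib, ← sum_add_distrib]
    exact sum_congr rfl fun j _ => by ring
  simp_rw [h, sum_add_distrib, sum_sub_distrib, ← sum_mul, hw, wVar]
  ring

lemma wVar_nonneg {w : Fin I → ℝ} (hw0 : ∀ i, 0 ≤ w i) (hw : ∑ i, w i = 1) (f : Fin I → ℝ) :
    0 ≤ wVar w f := by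
  rw [wVar_eq hw]
  exact mul_nonneg (by norm_num) (sum_nonneg fun i _ => sum_nonneg fun j _ =>
    mul_nonneg (mul_nonneg (hw0 i) (hw0 j)) (sq_nonneg _))

/-- For a doubly stochastic matrix, the decrease of the sum of squares is the sum of the variances
under the rows. -/
lemma sum_sq_sub_sum_sq_mulVec {M : Matrix (Fin I) (Fin I) ℝ} (hM : ∀ j, ∑ i, M i j = 1)
    (f : Fin I → ℝ) : ∑ i, f i ^ 2 - ∑ i, (∑ j, M i j * f j) ^ 2 = ∑ i, wVar (M i) f := by
  simp only [wVar, sum_sub_distrib]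
  congr 1
  rw [sum_comm]
  simp_rw [← sum_mul, hM, one_mul]

/-- The indicator of the agents whose rank is at most `d`. -/
def lowerCut (rk : Fin I → ℕ) (d : ℕ) (i : Fin I) : ℝ := if rk i ≤ d then 1 else 0

/-- A row with weights at least `κ` on both sides of a cut gives it variance at least `κ / 2`. -/
lemma le_wVar_lowerCut {w : Fin I → ℝ} (hw0 : ∀ i, 0 ≤ w i) (hw : ∑ i, w i = 1) {κ : ℝ}
    (rk : Fin I → ℕ) (d : ℕ) {a b : Fin I} (ha : rk a ≤ d) (hb : ¬ rk b ≤ d)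
    (hwa : κ ≤ w a) (hwb : κ ≤ w b) : κ / 2 ≤ wVar w (lowerCut rk d) := by
  have hsq : ∀ i, w i * lowerCut rk d i ^ 2 = w i * lowerCut rk d i := fun i => by
    unfold lowerCut; split_ifs <;> ring
  have h1 : w a ≤ ∑ i, w i * lowerCut rk d i := by
    have := single_le_sum (f := fun i => w i * lowerCut rk d i) (s := univ)
      (fun i _ => mul_nonneg (hw0 i) (by unfold lowerCut; split_ifs <;> norm_num)) (mem_univ a)
    simpa [lowerCut, ha] using this
  have h2 : w b ≤ ∑ i, w i * (1 - lowerCut rk d i) := by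
    have := single_le_sum (f := fun i => w i * (1 - lowerCut rk d i)) (s := univ)
      (fun i _ => mul_nonneg (hw0 i) (by unfold lowerCut; split_ifs <;> norm_num)) (mem_univ b)
    simpa [lowerCut, hb] using this
  simp_rw [mul_sub, mul_one, sum_sub_distrib, hw] at h2
  rw [wVar]
  simp_rw [hsq]
  set p := ∑ i, w i * lowerCut rk d i
  have hp0 : 0 ≤ p := (hw0 a).trans h1
  have hp1 : 0 ≤ 1 - p := (hw0 b).trans h2
  rcases le_total p (1 / 2) with h | h <;> nlinarith

/-- If each cut `d ∈ F` still separates the values of `y` by the original gap, the squared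
differences of `y` dominate the sum of the squared gaps of the cuts in between. -/
lemma sum_gap_sq_le {rk : Fin I → ℕ} {u : ℕ → ℝ} (hu : Monotone u) {y : Fin I → ℝ} {F : Finset ℕ}
    (hlow : ∀ d ∈ F, ∀ i, rk i ≤ d → y i ≤ u d)
    (hup : ∀ d ∈ F, ∀ i, ¬ rk i ≤ d → u (d + 1) ≤ y i) (i j : Fin I) :
    ∑ d ∈ F, (u (d + 1) - u d) ^ 2 * (lowerCut rk d i - lowerCut rk d j) ^ 2
      ≤ (y i - y j) ^ 2 := by
  have key : ∀ i j, rk i ≤ rk j →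
      ∑ d ∈ F, (u (d + 1) - u d) ^ 2 * (lowerCut rk d i - lowerCut rk d j) ^ 2
        ≤ (y i - y j) ^ 2 := by
    intro i j hij
    set F' := F.filter fun d => rk i ≤ d ∧ ¬ rk j ≤ d with hF'
    have hsum : ∑ d ∈ F, (u (d + 1) - u d) ^ 2 * (lowerCut rk d i - lowerCut rk d j) ^ 2
        = ∑ d ∈ F', (u (d + 1) - u d) ^ 2 := by
      rw [hF', sum_filter]
      refine sum_congr rfl fun d _ => ?_
      unfold lowerCut
      by_cases h1 : rk i ≤ d <;> by_cases h2 : rk j ≤ d <;> simp [h1, h2]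
      omega
    rw [hsum]
    rcases F'.eq_empty_or_nonempty with h | h
    · rw [h, sum_empty]; positivity
    · have hmin := F'.min'_mem h
      have hmax := F'.max'_mem h
      set a := F'.min' h
      set c := F'.max' h
      have hac : a ≤ c := F'.min'_le _ hmax
      rw [hF', mem_filter] at hmin hmax
      have h1 := hlow a hmin.1 i hmin.2.1
      have h2 := hup c hmax.1 j hmax.2.2
      have hg : ∀ d, 0 ≤ u (d + 1) - u d := fun d => sub_nonneg.2 (hu d.le_succ)
      have h3 : ∑ d ∈ F', (u (d + 1) - u d) ≤ u (c + 1) - u a := by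
        rw [← sum_Ico_sub u (by omega : a ≤ c + 1)]
        refine sum_le_sum_of_subset_of_nonneg (fun d hd => ?_) fun d _ _ => hg d
        rw [mem_Ico]
        exact ⟨F'.min'_le _ hd, Nat.lt_succ_of_le (F'.le_max' _ hd)⟩
      have h4 : 0 ≤ ∑ d ∈ F', (u (d + 1) - u d) := sum_nonneg fun d _ => hg d
      calc ∑ d ∈ F', (u (d + 1) - u d) ^ 2 ≤ (∑ d ∈ F', (u (d + 1) - u d)) ^ 2 :=
            sum_sq_le_sq_sum_of_nonneg fun d _ => hg d
        _ ≤ (y j - y i) ^ 2 := pow_le_pow_left₀ h4 (by linarith) 2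
        _ = _ := by ring
  rcases le_total (rk i) (rk j) with h | h
  · exact key i j h
  · have := key j i h
    simp_rw [sub_sq_comm] at this ⊢
    simpa only [sub_sq_comm (y j), sub_sq_comm (lowerCut rk _ j)] using this

variable {G : ℕ → Digraph (Fin I)} {B : ℕ} {A : ℕ → Matrix (Fin I) (Fin I) ℝ} {κ : ℝ}

/-- The decrease of the sum of squares in one window of length `B` is at least `κ / 2` times the sum
of the squared gaps between consecutive initial values: each gap is charged to the
first time at which a link crosses the corresponding cut. The initial values are `u (rk i)`, with
`u` increasing and `rk` the rank of an agent. -/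
lemma half_mul_sum_gap_sq_le (hG : IsBStronglyConnected G B) (hA : IsCompliant G A κ)
    (hcol : ColumnStochastic A) (hrow : RowStochastic A) {rk : Fin I → ℕ}
    (hrk : ∀ d < I, ∃ i, rk i = d) {u : ℕ → ℝ} (hu : Monotone u) (n : ℕ) :
    κ / 2 * ∑ d ∈ range (I - 1), (u (d + 1) - u d) ^ 2
      ≤ ∑ i, u (rk i) ^ 2 - ∑ i, (∑ j, transition A n B i j * u (rk j)) ^ 2 := by
  classical
  set y : ℕ → Fin I → ℝ := fun t i => ∑ j, transition A n t i j * u (rk j) with hy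
  have hy0 : ∀ i, y 0 i = u (rk i) := by simp [hy, transition, Matrix.one_apply]
  have hys : ∀ t i, y (t + 1) i = ∑ j, A (n + t) i j * y t j := by
    intro t i
    simp only [hy, transition_succ, Matrix.mul_apply, mul_sum, sum_mul, mul_assoc]
    exact sum_comm
  set cross : ℕ → ℕ → Prop := fun d s =>
    ∃ a b, ((G (n + s)).Adj a b ∨ (G (n + s)).Adj b a) ∧ rk a ≤ d ∧ ¬ rk b ≤ d with hcross
  have hex : ∀ d ∈ range (I - 1), ∃ s < B, cross d s := by
    intro d hd
    rw [mem_range] at hd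
    obtain ⟨a, ha⟩ := hrk d (by omega)
    obtain ⟨b, hb⟩ := hrk (d + 1) (by omega)
    obtain ⟨s, hs, a', ha', b', hb', h⟩ := hG.exists_crossing n (S := {i | rk i ≤ d})
      (u := a) (v := b) (by simp [ha]) (by simp [hb])
    exact ⟨s, hs, a', b', Or.inl h, ha', hb'⟩
  choose! τ hτ using fun d (hd : d ∈ range (I - 1)) =>
    (⟨Nat.find ⟨_, (hex d hd).choose_spec.2⟩,
      (Nat.find_min' _ (hex d hd).choose_spec.2).trans_lt (hex d hd).choose_spec.1,
      Nat.find_spec ⟨_, (hex d hd).choose_spec.2⟩,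
      fun s hs => Nat.find_min _ hs⟩ : ∃ t, t < B ∧ cross d t ∧ ∀ s < t, ¬ cross d s)
  -- cuts keep separating the values until they are first crossed
  have hsep : ∀ d t, (∀ s < t, ¬ cross d s) →
      ∀ i, (rk i ≤ d → y t i ≤ u d) ∧ (¬ rk i ≤ d → u (d + 1) ≤ y t i) := by
    intro d t
    induction t with
    | zero =>
      intro _ i
      rw [hy0]
      exact ⟨fun h => hu h, fun h => hu (by omega)⟩
    | succ t ih =>
      intro hs i
      have ih' := ih fun s h => hs s (by omega)
      have hzero : ∀ j, ¬ (rk i ≤ d ↔ rk j ≤ d) → A (n + t) i j = 0 := by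
        intro j hij
        refine hA.not_edge _ _ _ (fun h => hij (by rw [h])) fun hadj => hs t t.lt_succ_self ?_
        by_cases h : rk i ≤ d
        · exact ⟨i, j, Or.inr hadj, h, fun h' => hij ⟨fun _ => h', fun _ => h⟩⟩
        · refine ⟨j, i, Or.inl hadj, ?_, h⟩
          by_contra h'
          exact hij ⟨fun h'' => absurd h'' h, fun h'' => absurd h'' h'⟩
      rw [hys]
      have hone : ∀ c : ℝ, c = ∑ j, A (n + t) i j * c := fun c => by rw [← sum_mul, hrow, one_mul]
      constructor
      · intro hi
        rw [hone (u d)]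
        refine sum_le_sum fun j _ => ?_
        by_cases hj : rk j ≤ d
        · exact mul_le_mul_of_nonneg_left ((ih' j).1 hj) (hA.nonneg _ _ _)
        · rw [hzero j (by tauto), zero_mul, zero_mul]
      · intro hi
        rw [hone (u (d + 1))]
        refine sum_le_sum fun j _ => ?_
        by_cases hj : rk j ≤ d
        · rw [hzero j (by tauto), zero_mul, zero_mul]
        · exact mul_le_mul_of_nonneg_left ((ih' j).2 hj) (hA.nonneg _ _ _)
  set F : ℕ → Finset ℕ := fun t => (range (I - 1)).filter fun d => τ d = t with hF
  have hdec : ∀ t, κ / 2 * ∑ d ∈ F t, (u (d + 1) - u d) ^ 2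
      ≤ ∑ i, y t i ^ 2 - ∑ i, y (t + 1) i ^ 2 := by
    intro t
    have hFt : ∀ d ∈ F t, d ∈ range (I - 1) ∧ τ d = t := fun d hd => mem_filter.1 hd
    simp_rw [hys]
    rw [sum_sq_sub_sum_sq_mulVec (hcol (n + t))]
    have hvar : ∀ k, ∑ d ∈ F t, (u (d + 1) - u d) ^ 2 * wVar (A (n + t) k) (lowerCut rk d)
        ≤ wVar (A (n + t) k) (y t) := by
      intro k
      simp_rw [wVar_eq (hrow (n + t) k)]
      have hswap : ∑ d ∈ F t, (u (d + 1) - u d) ^ 2 * (1 / 2 * ∑ i, ∑ j,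
            A (n + t) k i * A (n + t) k j * (lowerCut rk d i - lowerCut rk d j) ^ 2)
          = 1 / 2 * ∑ i, ∑ j, A (n + t) k i * A (n + t) k j *
            ∑ d ∈ F t, (u (d + 1) - u d) ^ 2 * (lowerCut rk d i - lowerCut rk d j) ^ 2 := by
        simp_rw [mul_sum]
        rw [sum_comm]
        refine sum_congr rfl fun i _ => ?_
        rw [sum_comm]
        exact sum_congr rfl fun j _ => sum_congr rfl fun d _ => by ring
      rw [hswap]
      refine mul_le_mul_of_nonneg_left (sum_le_sum fun i _ => sum_le_sum fun j _ =>
        mul_le_mul_of_nonneg_left (sum_gap_sq_le hu ?_ ?_ i j)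
          (mul_nonneg (hA.nonneg _ _ _) (hA.nonneg _ _ _))) (by norm_num)
      · intro d hd i
        obtain ⟨h1, rfl⟩ := hFt d hd
        exact (hsep d _ (hτ d h1).2.2 i).1
      · intro d hd i
        obtain ⟨h1, rfl⟩ := hFt d hd
        exact (hsep d _ (hτ d h1).2.2 i).2
    refine le_trans ?_ (sum_le_sum fun k _ => hvar k)
    rw [sum_comm, mul_sum]
    refine sum_le_sum fun d hd => ?_
    rw [← mul_sum, mul_comm]
    refine mul_le_mul_of_nonneg_left ?_ (sq_nonneg _)
    obtain ⟨h1, rfl⟩ := hFt d hd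
    obtain ⟨a, b, hab, ha, hb⟩ := (hτ d h1).2.1
    have hk : ∃ k, κ / 2 ≤ wVar (A (n + τ d) k) (lowerCut rk d) := by
      rcases hab with h | h
      · exact ⟨b, le_wVar_lowerCut (hA.nonneg _ _) (hrow _ _) rk d ha hb (hA.le_of_adj h)
          (hA.diag _ _)⟩
      · exact ⟨a, le_wVar_lowerCut (hA.nonneg _ _) (hrow _ _) rk d ha hb (hA.diag _ _)
          (hA.le_of_adj h)⟩
    obtain ⟨k, hk⟩ := hk
    exact hk.trans (single_le_sum (f := fun k => wVar (A (n + τ d) k) (lowerCut rk d))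
      (fun k _ => wVar_nonneg (hA.nonneg _ _) (hrow _ _) _) (mem_univ k))
  have hfib : ∑ t ∈ range B, ∑ d ∈ F t, (u (d + 1) - u d) ^ 2
      = ∑ d ∈ range (I - 1), (u (d + 1) - u d) ^ 2 :=
    sum_fiberwise_of_maps_to (fun d hd => mem_range.2 (hτ d hd).1) _
  have htel := sum_le_sum fun t (_ : t ∈ range B) => hdec t
  rw [← mul_sum, hfib, sum_range_sub'] at htel
  simp_rw [hy0] at htel
  exact htel

lemma sum_sub_mean_sq (x : Fin I → ℝ) :
    ∑ i, (x i - ∑ j, 1 / (I : ℝ) * x j) ^ 2 = ∑ i, x i ^ 2 - (∑ i, x i) ^ 2 / I := by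
  rcases Nat.eq_zero_or_pos I with rfl | hI
  · simp
  have hI0 : (I : ℝ) ≠ 0 := by exact_mod_cast hI.ne'
  simp_rw [sub_sq, sum_add_distrib, sum_sub_distrib, ← mul_sum, ← sum_mul, ← mul_sum]
  simp
  field_simp
  ring

lemma sum_sub_mean_sq_le (x : Fin I → ℝ) (c : ℝ) :
    ∑ i, (x i - ∑ j, 1 / (I : ℝ) * x j) ^ 2 ≤ ∑ i, (x i - c) ^ 2 := by
  rcases Nat.eq_zero_or_pos I with rfl | hI
  · simp
  have hI0 : (0 : ℝ) < I := by exact_mod_cast hI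
  rw [sum_sub_mean_sq]
  have h : ∑ i, (x i - c) ^ 2 = ∑ i, x i ^ 2 - 2 * c * ∑ i, x i + I * c ^ 2 := by
    simp_rw [sub_sq, sum_add_distrib, sum_sub_distrib, mul_sum]
    simp [mul_right_comm]
  have h2 : (∑ i, x i) ^ 2 / I - 2 * c * ∑ i, x i + I * c ^ 2
      = (∑ i, x i - I * c) ^ 2 / I := by field_simp; ring
  have h3 : 0 ≤ (∑ i, x i - I * c) ^ 2 / (I : ℝ) := by positivity
  linarith

lemma column_sum_transition (hcol : ColumnStochastic A) (n k : ℕ) (j : Fin I) :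
    ∑ i, transition A n k i j = 1 := by
  simpa using sum_mul_transition (A := A) (p := fun _ _ => 1)
    (fun n j => by simpa using hcol n j) n k j

/-- One window of length `B` contracts the disagreement by `1 - κ / (2 I²)`. -/
lemma sum_sub_mean_sq_transition_le (hG : IsBStronglyConnected G B) (hA : IsCompliant G A κ)
    (hcol : ColumnStochastic A) (hrow : RowStochastic A) (hI : 1 ≤ I) (n : ℕ) (x : Fin I → ℝ) :
    ∑ i, (∑ j, transition A n B i j * x j
        - ∑ k, 1 / (I : ℝ) * ∑ j, transition A n B k j * x j) ^ 2
      ≤ (1 - κ / (2 * (I : ℝ) ^ 2)) * ∑ i, (x i - ∑ j, 1 / (I : ℝ) * x j) ^ 2 := by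
  have hI0 : (0 : ℝ) < I := by exact_mod_cast hI
  -- `u` lists the values of `x` in increasing order, and `rk i` is the position of `x i` in it
  set rk : Fin I → ℕ := fun i => ((Tuple.sort x).symm i : ℕ) with hrk
  set u : ℕ → ℝ := fun d => x (Tuple.sort x ⟨min d (I - 1), by omega⟩) with hu
  have hmono : Monotone u := fun a b hab =>
    Tuple.monotone_sort x (Fin.mk_le_mk.2 (min_le_min_right _ hab))
  have hux : ∀ i, u (rk i) = x i := fun i => by
    have h : (⟨min (rk i) (I - 1), by omega⟩ : Fin I) = (Tuple.sort x).symm i := by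
      ext
      have := ((Tuple.sort x).symm i).isLt
      simp only [hrk]
      omega
    simp only [hu, h, Equiv.apply_symm_apply]
  have h1 := half_mul_sum_gap_sq_le hG hA hcol hrow (rk := rk)
    (fun d hd => ⟨Tuple.sort x ⟨d, hd⟩, by simp [hrk]⟩) hmono n
  simp_rw [hux] at h1
  set S := ∑ d ∈ range (I - 1), (u (d + 1) - u d) ^ 2 with hS
  have h2 : ∑ i, (x i - ∑ j, 1 / (I : ℝ) * x j) ^ 2 ≤ (I : ℝ) ^ 2 * S := by
    refine (sum_sub_mean_sq_le x (u 0)).trans ?_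
    have : ∀ i ∈ (univ : Finset (Fin I)), (x i - u 0) ^ 2 ≤ I * S := by
      intro i _
      have hi : rk i < I := ((Tuple.sort x).symm i).isLt
      rw [← hux i, ← sum_range_sub]
      refine sq_sum_le_card_mul_sum_sq.trans ?_
      rw [card_range]
      refine mul_le_mul (by exact_mod_cast hi.le) ?_ (sum_nonneg fun _ _ => sq_nonneg _) hI0.le
      exact sum_le_sum_of_subset_of_nonneg (range_mono (by omega)) fun _ _ _ => sq_nonneg _
    refine (sum_le_sum this).trans_eq ?_
    simp; ring
  have hsum : ∑ i, ∑ j, transition A n B i j * x j = ∑ i, x i := by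
    rw [sum_comm]
    simp_rw [← sum_mul, column_sum_transition hcol, one_mul]
  rw [sum_sub_mean_sq, hsum]
  have h3 : κ / (2 * (I : ℝ) ^ 2) * ∑ i, (x i - ∑ j, 1 / (I : ℝ) * x j) ^ 2 ≤ κ / 2 * S := by
    calc _ ≤ κ / (2 * (I : ℝ) ^ 2) * ((I : ℝ) ^ 2 * S) :=
          mul_le_mul_of_nonneg_left h2 (by have := hA.κ_pos; positivity)
      _ = κ / 2 * S := by field_simp
  rw [sum_sub_mean_sq] at h3 ⊢
  linarith

lemma sum_sq_transition_le (hA0 : ∀ n i j, 0 ≤ A n i j)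
    (hcol : ColumnStochastic A) (hrow : RowStochastic A) (n k : ℕ) (x : Fin I → ℝ) :
    ∑ i, (∑ j, transition A n k i j * x j) ^ 2 ≤ ∑ i, x i ^ 2 := by
  have h := sum_sq_sub_sum_sq_mulVec (column_sum_transition hcol n k) x
  have h2 : 0 ≤ ∑ i, wVar (transition A n k i) x := sum_nonneg fun i _ =>
    wVar_nonneg (transition_nonneg hA0 n k i) (transition_row_sum hrow n k i) x
  linarith

lemma stackNorm_sq_eq_sum_coord (v : Fin I → Vec m) :
    stackNorm v ^ 2 = ∑ k, ∑ i, (v i k) ^ 2 := by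
  rw [stackNorm_sq, sum_comm]
  simp [EuclideanSpace.norm_sq_eq]

lemma act_coord (M : Matrix (Fin I) (Fin I) ℝ) (v : Fin I → Vec m) (i : Fin I) (k : Fin m) :
    act M v i k = ∑ j, M i j * v j k := by simp [act]

lemma dev_coord (p : Fin I → ℝ) (v : Fin I → Vec m) (i : Fin I) (k : Fin m) :
    dev p v i k = v i k - ∑ j, p j * v j k := by simp [dev]

lemma isMixing_of_doublyStochastic (hG : IsBStronglyConnected G B) (hA : IsCompliant G A κ)
    (hcol : ColumnStochastic A) (hrow : RowStochastic A) (hI : 1 ≤ I) :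
    IsMixing m A (fun _ _ => 1 / (I : ℝ)) B (√(1 - κ / (2 * (I : ℝ) ^ 2))) 1 1 where
  contract n v := by
    have hI1 : (1 : ℝ) ≤ I := by exact_mod_cast hI
    have hκ : κ / (2 * (I : ℝ) ^ 2) ≤ 1 := by
      rw [div_le_one (by positivity)]
      nlinarith [hA.le_one hcol hI]
    refine abs_le_of_sq_le_sq' ?_ (mul_nonneg (Real.sqrt_nonneg _) (stackNorm_nonneg _)) |>.2
    rw [mul_pow, Real.sq_sqrt (by linarith), stackNorm_sq_eq_sum_coord, stackNorm_sq_eq_sum_coord,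
      mul_sum]
    refine sum_le_sum fun k _ => ?_
    simp_rw [dev_coord, act_coord]
    exact sum_sub_mean_sq_transition_le hG hA hcol hrow hI n fun j => v j k
  bounded n k v := by
    rw [one_mul]
    refine abs_le_of_sq_le_sq' ?_ (stackNorm_nonneg _) |>.2
    rw [stackNorm_sq_eq_sum_coord, stackNorm_sq_eq_sum_coord]
    refine sum_le_sum fun l _ => ?_
    simp_rw [dev_coord, act_coord]
    refine (sum_sub_mean_sq_le _ 0).trans ?_
    simp_rw [sub_zero]
    exact sum_sq_transition_le hA.nonneg hcol hrow n k _
  step n v := by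
    rw [one_mul]
    refine abs_le_of_sq_le_sq' ?_ (stackNorm_nonneg _) |>.2
    rw [stackNorm_sq_eq_sum_coord, stackNorm_sq_eq_sum_coord]
    refine sum_le_sum fun l _ => ?_
    simp_rw [act_coord]
    simpa [transition] using sum_sq_transition_le hA.nonneg hcol hrow n 1 fun j => v j l

end DoublyStochasticMixing

end Sonata

namespace Sonata

open Set Filter Topology

/-! ### Convex analysis -/

section ConvexAnalysis

variable {E : Type*} [NormedAddCommGroup E] [InnerProductSpace ℝ E] [CompleteSpace E]
  {K : Set E} {f : E → ℝ} {g x y : E}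

lemma hasDerivWithinAt_segment (hK : Convex ℝ K) (hx : x ∈ K) (hy : y ∈ K)
    (hf : HasGradientWithinAt f g K x) :
    HasDerivWithinAt (fun s : ℝ => f (x + s • (y - x))) (inner ℝ g (y - x)) (Icc 0 1) 0 := by
  have h1 : HasDerivWithinAt (fun s : ℝ => x + s • (y - x)) (y - x) (Icc 0 1) 0 := by
    simpa using ((hasDerivWithinAt_id (0 : ℝ) (Icc 0 1)).smul_const (y - x)).const_add x
  have h2 : HasFDerivWithinAt f (InnerProductSpace.toDual ℝ E g) K (x + (0 : ℝ) • (y - x)) := by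
    simpa using hf.hasFDerivWithinAt
  exact (h2.comp_hasDerivWithinAt (0 : ℝ) h1 fun s hs => hK.add_smul_sub_mem hx hy hs).congr_deriv
    (by simp)

lemma nonneg_of_hasDerivWithinAt_of_le {ψ : ℝ → ℝ} {a : ℝ}
    (h : HasDerivWithinAt ψ a (Icc 0 1) 0) (hψ : ∀ s ∈ Icc (0 : ℝ) 1, ψ 0 ≤ ψ s) : 0 ≤ a := by
  have h' := (h.mono Ioc_subset_Icc_self : HasDerivWithinAt ψ a (Ioc 0 1) 0)
  rw [hasDerivWithinAt_iff_tendsto_slope' (by simp)] at h'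
  have : (𝓝[Ioc (0 : ℝ) 1] 0).NeBot := by
    rw [nhdsWithin_Ioc_eq_nhdsGT zero_lt_one]; infer_instance
  refine ge_of_tendsto h' ?_
  filter_upwards [self_mem_nhdsWithin] with s hs
  rw [slope_def_field]
  exact div_nonneg (sub_nonneg.2 (hψ s ⟨hs.1.le, hs.2⟩)) (by simpa using hs.1.le)

/-- First-order optimality for the sum of a differentiable function `f` and a convex function `G`
minimized over a convex set. -/
lemma inner_add_sub_nonneg_of_isMinOn {G : E → ℝ} (hG : ConvexOn ℝ K G)
    (hf : HasGradientWithinAt f g K x) (hx : x ∈ K) (hmin : IsMinOn (fun z => f z + G z) K x)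
    (hy : y ∈ K) : 0 ≤ inner ℝ g (y - x) + (G y - G x) := by
  have h1 := (hasDerivWithinAt_segment hG.1 hx hy hf).add
    ((hasDerivWithinAt_id (0 : ℝ) (Icc 0 1)).mul_const (G y - G x))
  rw [one_mul] at h1
  refine nonneg_of_hasDerivWithinAt_of_le h1 fun s hs => ?_
  have h2 : f x + G x ≤ f (x + s • (y - x)) + G (x + s • (y - x)) :=
    hmin (hG.1.add_smul_sub_mem hx hy hs)
  have h3 : G (x + s • (y - x)) ≤ (1 - s) • G x + s • G y := by
    have := hG.2 hx hy (sub_nonneg.2 hs.2) hs.1 (by ring)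
    rwa [show (1 - s) • x + s • y = x + s • (y - x) by module] at this
  simp only [smul_eq_mul] at h3
  simp
  linarith

lemma add_inner_add_le_of_strongConvexOn {τ : ℝ} (hf : StrongConvexOn K τ f)
    (hg : HasGradientWithinAt f g K x) (hx : x ∈ K) (hy : y ∈ K) :
    f x + inner ℝ g (y - x) + τ / 2 * ‖y - x‖ ^ 2 ≤ f y := by
  have hid := hasDerivWithinAt_id (0 : ℝ) (Icc 0 1)
  -- the nonnegative gap in the strong convexity inequality along the segment vanishes at `0`
  have h1 := ((hid.mul_const (f y - f x - τ / 2 * ‖y - x‖ ^ 2)).add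
    ((hid.mul hid).mul_const (τ / 2 * ‖y - x‖ ^ 2))).sub
    (hasDerivWithinAt_segment hf.1 hx hy hg)
  have h2 := nonneg_of_hasDerivWithinAt_of_le h1 fun s hs => ?_
  · simp at h2
    linarith
  · have h3 := hf.2 hx hy (sub_nonneg.2 hs.2) hs.1 (by ring)
    have e : (1 - s) • x + s • y = x + s • (y - x) := by module
    rw [e, norm_sub_rev] at h3
    simp only [smul_eq_mul] at h3
    simp
    linarith

/-- The descent lemma on a convex set. -/
lemma le_add_inner_add_of_lipschitzOnWith {gr : E → E} {ℓ : ℝ} (hK : Convex ℝ K)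
    (hf : ∀ z ∈ K, HasGradientAt f (gr z) z)
    (hℓ : ∀ z ∈ K, ∀ w ∈ K, ‖gr z - gr w‖ ≤ ℓ * ‖z - w‖) (hx : x ∈ K) (hy : y ∈ K) :
    f y ≤ f x + inner ℝ (gr x) (y - x) + ℓ / 2 * ‖y - x‖ ^ 2 := by
  set ψ : ℝ → ℝ := fun s => f (x + s • (y - x))
    - (s * inner ℝ (gr x) (y - x) + s ^ 2 * (ℓ / 2 * ‖y - x‖ ^ 2)) with hψ
  have hder : ∀ s ∈ Icc (0 : ℝ) 1, HasDerivAt ψ (inner ℝ (gr (x + s • (y - x))) (y - x)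
      - (inner ℝ (gr x) (y - x) + 2 * s * (ℓ / 2 * ‖y - x‖ ^ 2))) s := by
    intro s hs
    have h1 : HasDerivAt (fun s : ℝ => x + s • (y - x)) (y - x) s := by
      simpa using ((hasDerivAt_id s).smul_const (y - x)).const_add x
    have h2 := (hf _ (hK.add_smul_sub_mem hx hy hs)).hasFDerivAt.comp_hasDerivAt s h1
    have h3 := ((hasDerivAt_id s).mul_const (inner ℝ (gr x) (y - x))).add
      ((hasDerivAt_pow 2 s).mul_const (ℓ / 2 * ‖y - x‖ ^ 2))
    exact (h2.sub h3).congr_deriv (by simp)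
  have hanti : AntitoneOn ψ (Icc 0 1) := by
    refine antitoneOn_of_hasDerivWithinAt_nonpos (convex_Icc 0 1)
      (fun s hs => (hder s hs).continuousAt.continuousWithinAt)
      (fun s hs => (hder s (interior_subset hs)).hasDerivWithinAt) fun s hs => ?_
    have hs' := interior_subset hs
    have h1 := hℓ _ (hK.add_smul_sub_mem hx hy hs') _ hx
    rw [add_sub_cancel_left, norm_smul, Real.norm_of_nonneg hs'.1] at h1
    have h2 := real_inner_le_norm (gr (x + s • (y - x)) - gr x) (y - x)
    rw [inner_sub_left] at h2
    nlinarith [norm_nonneg (y - x)]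
  have h := hanti (left_mem_Icc.2 zero_le_one) (right_mem_Icc.2 zero_le_one) zero_le_one
  simp [hψ] at h
  linarith

end ConvexAnalysis

section ProximalPoint

/-- A convex lower semicontinuous function plus a linear function and a squared distance attains
its minimum over a closed convex set: it grows at least linearly away from `x`, by comparison with
its minimum over the unit ball, and the squared distance dominates. -/
lemma exists_isMinOn_inner_add_sq_add {E : Type*} [NormedAddCommGroup E] [InnerProductSpace ℝ E]
    [ProperSpace E] {K : Set E} {G : E → ℝ} {x : E} (hK : IsClosed K)
    (hG : ConvexOn ℝ K G) (hlsc : LowerSemicontinuousOn G K) (hx : x ∈ K) (a : E) :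
    ∃ p ∈ K, IsMinOn (fun z => inner ℝ a (z - x) + 1 / 2 * ‖z - x‖ ^ 2 + G z) K p := by
  have hcomp : ∀ R, IsCompact (K ∩ Metric.closedBall x R) := fun R =>
    (isCompact_closedBall x R).inter_left hK
  obtain ⟨c, hc⟩ := LowerSemicontinuousOn.bddBelow_of_isCompact (hcomp 1)
    (hlsc.mono inter_subset_left)
  have hc' : ∀ z ∈ K, ‖z - x‖ ≤ 1 → c ≤ G z := fun z hz h =>
    hc ⟨z, ⟨hz, by simpa [dist_eq_norm] using h⟩, rfl⟩
  have hcx : c ≤ G x := hc' x hx (by simp)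
  set R := max 1 (2 * (‖a‖ + (G x - c)))
  obtain ⟨p, hp, hmin⟩ := LowerSemicontinuousOn.exists_isMinOn
    (f := fun z => inner ℝ a (z - x) + 1 / 2 * ‖z - x‖ ^ 2 + G z)
    (s := K ∩ Metric.closedBall x R)
    ⟨x, hx, Metric.mem_closedBall_self (le_max_of_le_left zero_le_one)⟩ (hcomp R)
    ((Continuous.continuousOn (by fun_prop)).lowerSemicontinuousOn.add
      (hlsc.mono inter_subset_left))
  refine ⟨p, hp.1, fun z hz => ?_⟩
  rcases le_or_gt ‖z - x‖ R with h | h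
  · exact hmin ⟨hz, by simpa [dist_eq_norm] using h⟩
  have hpx : inner ℝ a (p - x) + 1 / 2 * ‖p - x‖ ^ 2 + G p ≤ G x := by
    have := hmin (show x ∈ K ∩ Metric.closedBall x R from
      ⟨hx, Metric.mem_closedBall_self (le_max_of_le_left zero_le_one)⟩)
    simpa using this
  refine hpx.trans ?_
  set t := ‖z - x‖ with ht
  have ht1 : 1 < t := (le_max_left _ _).trans_lt h
  have htR : 2 * (‖a‖ + (G x - c)) < t := (le_max_right _ _).trans_lt h
  have ht0 : 0 < t := by linarith
  have hs : t⁻¹ ∈ Icc (0 : ℝ) 1 := ⟨by positivity, inv_le_one_of_one_le₀ ht1.le⟩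
  have h1 : c ≤ G (x + t⁻¹ • (z - x)) := by
    refine hc' _ (hG.1.add_smul_sub_mem hx hz hs) ?_
    rw [add_sub_cancel_left, norm_smul, Real.norm_of_nonneg hs.1, ← ht,
      inv_mul_cancel₀ ht0.ne']
  have h2 : G (x + t⁻¹ • (z - x)) ≤ (1 - t⁻¹) • G x + t⁻¹ • G z := by
    have := hG.2 hx hz (sub_nonneg.2 hs.2) hs.1 (by ring)
    rwa [show (1 - t⁻¹) • x + t⁻¹ • z = x + t⁻¹ • (z - x) by module] at this
  simp only [smul_eq_mul] at h2
  have h3 : G x + t * (c - G x) ≤ G z := by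
    have h4 := mul_le_mul_of_nonneg_left (h1.trans h2) ht0.le
    have h5 : t * ((1 - t⁻¹) * G x + t⁻¹ * G z) = t * G x - G x + G z := by
      field_simp
    linarith
  have h6 : -(‖a‖ * t) ≤ inner ℝ a (z - x) := by
    have := abs_real_inner_le_norm a (z - x)
    exact (abs_le.1 this).1
  change G x ≤ inner ℝ a (z - x) + 1 / 2 * t ^ 2 + G z
  nlinarith

end ProximalPoint

end Sonata

namespace Sonata

open Finset

/-! ### Variational inequalities for the subproblems -/

section Subproblems

variable {I m : ℕ} {K : Set (Vec m)}

lemma hasGradientAt_inner_sub (a x₀ p : Vec m) :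
    HasGradientAt (fun z => inner ℝ a (z - x₀)) a p := by
  rw [hasGradientAt_iff_hasFDerivAt]
  exact ((InnerProductSpace.toDual ℝ (Vec m) a).hasFDerivAt.comp p
    ((hasFDerivAt_id p).sub_const x₀)).congr_fderiv (by ext; simp)

lemma hasGradientAt_half_norm_sub_sq (x₀ p : Vec m) :
    HasGradientAt (fun z => 1 / 2 * ‖z - x₀‖ ^ 2) (p - x₀) p := by
  rw [hasGradientAt_iff_hasFDerivAt]
  refine ((((hasFDerivAt_id p).sub_const x₀).norm_sq).const_mul (1 / 2)).congr_fderiv ?_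
  ext v
  simp

/-- Two variational inequalities, one of them with a proximal term centered at `c`, bound
the distance from `c` to the solution of the proximal one. -/
lemma norm_sub_le_of_variational {G : Vec m → ℝ} {a b c p q : Vec m}
    (hp : p ∈ K) (hq : q ∈ K)
    (h1 : ∀ w ∈ K, 0 ≤ inner ℝ (a + (p - c)) (w - p) + (G w - G p))
    (h2 : ∀ w ∈ K, 0 ≤ inner ℝ b (w - q) + (G w - G q)) :
    ‖c - p‖ ≤ 2 * ‖q - c‖ + ‖a - b‖ := by
  have h3 : ‖q - p‖ ≤ ‖a - b‖ + ‖q - c‖ := by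
    have h := add_nonneg (h1 q hq) (h2 p hp)
    have e : inner ℝ (a + (p - c)) (q - p) + inner ℝ b (p - q)
        = inner ℝ (a - b + (q - c)) (q - p) - inner ℝ (q - p) (q - p) := by
      rw [← neg_sub q p, inner_neg_right, ← sub_eq_add_neg, ← inner_sub_left, ← inner_sub_left]
      congr 1
      abel
    rw [real_inner_self_eq_norm_sq] at e
    have h4 := (real_inner_le_norm (a - b + (q - c)) (q - p)).trans
      (mul_le_mul_of_nonneg_right (norm_add_le _ _) (norm_nonneg _))
    have h5 : ‖q - p‖ * ‖q - p‖ ≤ (‖a - b‖ + ‖q - c‖) * ‖q - p‖ := by nlinarith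
    rcases (norm_nonneg (q - p)).eq_or_lt' with h6 | h6
    · rw [h6]; positivity
    · exact le_of_mul_le_mul_right h5 h6
  have h4 : ‖c - p‖ ≤ ‖q - p‖ + ‖q - c‖ := by
    have := norm_sub_le (q - p) (q - c)
    rwa [sub_sub_sub_cancel_left] at this
  linarith

variable {P : Problem I m} {L : Fin I → ℝ≥0} {LG : ℝ≥0}
  {ft : Fin I → Vec m → Vec m → ℝ} {gft : Fin I → Vec m → Vec m → Vec m} {τ : Fin I → ℝ}
  {Lt : Fin I → ℝ≥0}

/-- The gradient of the smooth part `∑ i, f i - Gm` of the objective. -/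
noncomputable def Problem.smoothGradient (P : Problem I m) (z : Vec m) : Vec m :=
  (∑ i, gradient (P.f i) z) - gradient P.Gm z

lemma Problem.Standing.hasGradientAt_f (hP : P.Standing L LG) (i : Fin I) {z : Vec m}
    (hz : z ∈ P.K) : HasGradientAt (P.f i) (gradient (P.f i) z) z :=
  (((hP.f_contDiff i).differentiableOn one_ne_zero).differentiableAt
    (hP.isOpen.mem_nhds (hP.subset hz))).hasGradientAt

lemma Problem.Standing.hasGradientAt_Gm (hP : P.Standing L LG) {z : Vec m}
    (hz : z ∈ P.K) : HasGradientAt P.Gm (gradient P.Gm z) z :=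
  ((hP.Gm_contDiff.differentiableOn one_ne_zero).differentiableAt
    (hP.isOpen.mem_nhds (hP.subset hz))).hasGradientAt

lemma Problem.Standing.hasGradientAt_smooth (hP : P.Standing L LG) {z : Vec m} (hz : z ∈ P.K) :
    HasGradientAt (fun z => ∑ i, P.f i z - P.Gm z) (P.smoothGradient z) z := by
  rw [hasGradientAt_iff_hasFDerivAt]
  have h1 := HasFDerivAt.fun_sum (u := univ) fun i _ => (hP.hasGradientAt_f i hz).hasFDerivAt
  refine (h1.sub (hP.hasGradientAt_Gm hz).hasFDerivAt).congr_fderiv ?_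
  simp [Problem.smoothGradient]

lemma Problem.Standing.norm_sum_gradient_sub_le (hP : P.Standing L LG) {z : Vec m} (hz : z ∈ P.K)
    {x : Fin I → Vec m} (hx : ∀ i, x i ∈ P.K) {d : ℝ} (hd : ∀ i, ‖x i - z‖ ≤ d) :
    ‖∑ i, gradient (P.f i) z - ∑ i, gradient (P.f i) (x i)‖ ≤ Lsum L * d := by
  rw [← sum_sub_distrib, Lsum, sum_mul]
  refine norm_sum_le_of_le _ fun i _ => ((hP.f_lipschitz i).norm_sub_le hz (hx i)).trans ?_
  rw [norm_sub_rev]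
  exact mul_le_mul_of_nonneg_left (hd i) (L i).coe_nonneg

lemma Problem.Standing.norm_smoothGradient_sub_le (hP : P.Standing L LG) {z w : Vec m}
    (hz : z ∈ P.K) (hw : w ∈ P.K) :
    ‖P.smoothGradient z - P.smoothGradient w‖ ≤ (Lsum L + LG) * ‖z - w‖ := by
  have h1 := hP.norm_sum_gradient_sub_le hz (x := fun _ => w) (fun _ => hw)
    (fun _ => (norm_sub_rev w z).le)
  have h2 := hP.Gm_lipschitz.norm_sub_le hz hw
  rw [Problem.smoothGradient, Problem.smoothGradient, sub_sub_sub_comm, add_mul]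
  exact (norm_sub_le _ _).trans (add_le_add h1 h2)

lemma Problem.Standing.isArgmin_stationarityPoint (hP : P.Standing L LG) {z : Vec m}
    (hz : z ∈ P.K) : IsArgmin P.K (P.stationarityModel z) (P.stationarityPoint z) := by
  obtain ⟨p, hp, hmin⟩ := exists_isMinOn_inner_add_sq_add hP.isClosed hP.Gp_convex hP.Gp_lsc hz
    (P.smoothGradient z)
  exact Classical.epsilon_spec (p := fun p => IsArgmin P.K (P.stationarityModel z) p) ⟨p, hp, hmin⟩

lemma Problem.Standing.stationarityPoint_variational (hP : P.Standing L LG) {z w : Vec m}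
    (hz : z ∈ P.K) (hw : w ∈ P.K) :
    0 ≤ inner ℝ (P.smoothGradient z + (P.stationarityPoint z - z)) (w - P.stationarityPoint z)
      + (P.Gp w - P.Gp (P.stationarityPoint z)) := by
  obtain ⟨h1, h2⟩ := hP.isArgmin_stationarityPoint hz
  refine inner_add_sub_nonneg_of_isMinOn hP.Gp_convex (f := fun v =>
    inner ℝ (P.smoothGradient z) (v - z) + 1 / 2 * ‖v - z‖ ^ 2) ?_ h1 h2 hw
  rw [hasGradientWithinAt_iff_hasFDerivWithinAt, map_add]
  exact ((hasGradientAt_inner_sub _ _ _).hasFDerivAt.add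
    (hasGradientAt_half_norm_sub_sq _ _).hasFDerivAt).hasFDerivWithinAt

/-- First-order optimality of the local solutions. -/
lemma localModel_variational (hP : P.Standing L LG) (hft : IsSurrogate P ft gft τ Lt) {i : Fin I}
    {x xt y w : Vec m} (hx : x ∈ P.K) (h : IsArgmin P.K (localModel P ft i x y) xt) (hw : w ∈ P.K) :
    0 ≤ inner ℝ (gft i xt x - gradient P.Gm x + ((I : ℝ) • y - gradient (P.f i) x)) (w - xt)
      + (P.Gp w - P.Gp xt) := by
  refine inner_add_sub_nonneg_of_isMinOn hP.Gp_convex (f := fun v =>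
    ft i v x - inner ℝ (gradient P.Gm x) (v - x)
      + inner ℝ ((I : ℝ) • y - gradient (P.f i) x) (v - x)) ?_ h.1 h.2 hw
  rw [hasGradientWithinAt_iff_hasFDerivWithinAt, map_add, map_sub]
  exact ((hft.hasGradient i xt h.1 x hx).hasFDerivWithinAt.sub
    (hasGradientAt_inner_sub _ _ _).hasFDerivAt.hasFDerivWithinAt).add
    (hasGradientAt_inner_sub _ _ _).hasFDerivAt.hasFDerivWithinAt

/-- The local direction is a descent direction for the local model with the
tracked gradient. -/
lemma inner_direction_le (hP : P.Standing L LG) (hft : IsSurrogate P ft gft τ Lt) {i : Fin I}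
    {x xt y : Vec m} (hx : x ∈ P.K) (h : IsArgmin P.K (localModel P ft i x y) xt) :
    inner ℝ ((I : ℝ) • y - gradient P.Gm x) (xt - x) + (P.Gp xt - P.Gp x)
      ≤ -(τ i * ‖xt - x‖ ^ 2) := by
  have h1 := localModel_variational hP hft hx h hx
  have hs := hft.strongConvex i x hx
  have h2 := add_inner_add_le_of_strongConvexOn hs (hft.hasGradient i xt h.1 x hx) h.1 hx
  have h3 := add_inner_add_le_of_strongConvexOn hs (hft.hasGradient i x hx x hx) hx h.1
  rw [hft.gradient_diag i x hx] at h3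
  rw [← neg_sub xt x] at h1 h2
  rw [norm_neg] at h2
  simp only [inner_add_left, inner_sub_left, inner_neg_right] at h1 h2 h3 ⊢
  linarith

lemma avg_mem (hK : Convex ℝ P.K) (hI : 1 ≤ I) {x : Fin I → Vec m} (hx : ∀ i, x i ∈ P.K) :
    avg x ∈ P.K := by
  have hI0 : (I : ℝ) ≠ 0 := by exact_mod_cast (by omega : I ≠ 0)
  rw [avg, smul_sum]
  exact hK.sum_mem (fun _ _ => by positivity) (by simp [hI0]) fun i _ => hx i

/-- The mean minimizes the sum of squared distances. -/
lemma D_le (x : Fin I → Vec m) (a : Vec m) : D x ≤ stackNorm fun i => x i - a := by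
  refine abs_le_of_sq_le_sq' ?_ (stackNorm_nonneg _) |>.2
  change stackNorm (fun i => x i - avg x) ^ 2 ≤ _
  rw [stackNorm_sq_eq_sum_coord, stackNorm_sq_eq_sum_coord]
  refine sum_le_sum fun k _ => ?_
  simpa [avg, mul_sum] using sum_sub_mean_sq_le (fun i => x i k) (a k)

end Subproblems

/-! ### One iteration -/

section Iteration

variable {I m : ℕ}

/-- A run of the algorithm for a standing problem and surrogates, with mass-preserving nonnegative
weights, with `φ` between `lb > 0` and `ub`, and with a step-size in `(0, 1]`. -/
structure IsBoundedRun (P : Problem I m) (L : Fin I → ℝ≥0) (LG : ℝ≥0)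
    (ft : Fin I → Vec m → Vec m → ℝ) (gft : Fin I → Vec m → Vec m → Vec m) (τ : Fin I → ℝ)
    (Lt : Fin I → ℝ≥0) (A : ℕ → Matrix (Fin I) (Fin I) ℝ) (α : ℝ)
    (x xt y : ℕ → Fin I → Vec m) (φ : ℕ → Fin I → ℝ) (lb ub : ℝ) : Prop where
  one_le : 1 ≤ I
  standing : P.Standing L LG
  surrogate : IsSurrogate P ft gft τ Lt
  run : IsRun P ft A α x xt y φ
  weights_nonneg : ∀ n i j, 0 ≤ A n i j
  columnStochastic : ColumnStochastic A
  lb_pos : 0 < lb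
  lb_le : ∀ n i, lb ≤ φ n i
  le_ub : ∀ n i, φ n i ≤ ub
  step_pos : 0 < α
  step_le : α ≤ 1

/-- The weights of the average that the algorithm preserves. -/
noncomputable def mass (φ : ℕ → Fin I → ℝ) (n : ℕ) (i : Fin I) : ℝ := φ n i / I

/-- The weighted average of the agents' copies. -/
noncomputable def center (φ : ℕ → Fin I → ℝ) (x : ℕ → Fin I → Vec m) (n : ℕ) :
    Vec m := ∑ j, mass φ n j • x n j

/-- The Lyapunov function: the smooth part at the weighted average plus the weighted average of the
values of the convex part. -/
noncomputable def lyapunov (P : Problem I m) (φ : ℕ → Fin I → ℝ)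
    (x : ℕ → Fin I → Vec m) (n : ℕ) : ℝ :=
  (∑ i, P.f i (center φ x n) - P.Gm (center φ x n)) + ∑ j, mass φ n j * P.Gp (x n j)

lemma cTau_le (τ : Fin I → ℝ) (i : Fin I) : cTau τ ≤ τ i :=
  ciInf_le (Set.finite_range τ).bddBelow i

lemma one_div_smul_sum_weights (A : ℕ → Matrix (Fin I) (Fin I) ℝ) (φ : ℕ → Fin I → ℝ) (n : ℕ)
    (v : Fin I → Vec m) (i : Fin I) :
    (1 / φ (n + 1) i) • ∑ j, (A n i j * φ n j) • v j = act (ratioWeights A φ n) v i := by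
  simp only [act, ratioWeights, Matrix.of_apply, smul_sum, smul_smul]
  exact sum_congr rfl fun j _ => by rw [one_div_mul_eq_div]

namespace IsBoundedRun

variable {P : Problem I m} {L : Fin I → ℝ≥0} {LG : ℝ≥0} {ft : Fin I → Vec m → Vec m → ℝ}
  {gft : Fin I → Vec m → Vec m → Vec m} {τ : Fin I → ℝ} {Lt : Fin I → ℝ≥0}
  {A : ℕ → Matrix (Fin I) (Fin I) ℝ} {α : ℝ} {x xt y : ℕ → Fin I → Vec m} {φ : ℕ → Fin I → ℝ}
  {lb ub : ℝ}

variable (h : IsBoundedRun P L LG ft gft τ Lt A α x xt y φ lb ub)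

include h

lemma cast_pos : (0 : ℝ) < I := by exact_mod_cast h.one_le

lemma phi_pos (n : ℕ) (i : Fin I) : 0 < φ n i := h.lb_pos.trans_le (h.lb_le n i)

lemma mass_nonneg (n : ℕ) (i : Fin I) : 0 ≤ mass φ n i := (div_pos (h.phi_pos n i) h.cast_pos).le

lemma sum_mass (n : ℕ) : ∑ i, mass φ n i = 1 := by
  simp only [mass]
  rw [← sum_div, sum_phi h.columnStochastic h.run.φ_zero h.run.φ_succ, div_self h.cast_pos.ne']

lemma weights_row_sum (n : ℕ) (i : Fin I) : ∑ j, ratioWeights A φ n i j = 1 :=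
  ratioWeights_row_sum h.phi_pos h.run.φ_succ n i

lemma ratioWeights_nonneg (n : ℕ) (i j : Fin I) : 0 ≤ ratioWeights A φ n i j :=
  div_nonneg (mul_nonneg (h.weights_nonneg _ _ _) (h.phi_pos _ _).le) (h.phi_pos _ _).le

lemma sum_mass_mul (n : ℕ) (j : Fin I) :
    ∑ i, mass φ (n + 1) i * ratioWeights A φ n i j = mass φ n j :=
  sum_div_mul_ratioWeights h.columnStochastic h.phi_pos n j

lemma sum_mass_smul_act (n : ℕ) (v : Fin I → Vec m) :
    ∑ i, mass φ (n + 1) i • act (ratioWeights A φ n) v i = ∑ j, mass φ n j • v j := by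
  simp_rw [act, smul_sum, smul_smul]
  rw [sum_comm]
  simp_rw [← sum_smul, h.sum_mass_mul]

lemma x_succ (n : ℕ) :
    x (n + 1) = act (ratioWeights A φ n) (x n + α • (xt n - x n)) := by
  funext i
  rw [h.run.x_succ, ← one_div_smul_sum_weights]
  rfl

lemma x_succ_eq_add (n : ℕ) :
    x (n + 1) = act (ratioWeights A φ n) (x n)
      + α • act (ratioWeights A φ n) (xt n - x n) := by
  rw [h.x_succ, act_add, act_smul]

lemma y_succ (n : ℕ) : y (n + 1) = act (ratioWeights A φ n) (y n) + fun i =>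
    (1 / φ (n + 1) i) • (gradient (P.f i) (x (n + 1) i) - gradient (P.f i) (x n i)) := by
  funext i
  rw [h.run.y_succ, one_div_smul_sum_weights]
  rfl

lemma xt_mem (n : ℕ) (i : Fin I) : xt n i ∈ P.K := (h.run.xt_argmin n i).1

lemma moved_mem {n : ℕ} {i : Fin I} (hx : x n i ∈ P.K) :
    (x n + α • (xt n - x n)) i ∈ P.K :=
  h.standing.convex.add_smul_sub_mem hx (h.xt_mem n i) ⟨h.step_pos.le, h.step_le⟩

lemma x_mem (n : ℕ) (i : Fin I) : x n i ∈ P.K := by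
  induction n generalizing i with
  | zero => exact h.run.x_zero i
  | succ n ih =>
    rw [h.x_succ]
    exact h.standing.convex.sum_mem (fun j _ => h.ratioWeights_nonneg n i j)
      (h.weights_row_sum n i) fun j _ => h.moved_mem (ih j)

lemma center_mem (n : ℕ) : center φ x n ∈ P.K :=
  h.standing.convex.sum_mem (fun i _ => h.mass_nonneg n i) (h.sum_mass n) fun i _ => h.x_mem n i

lemma center_succ (n : ℕ) :
    center φ x (n + 1) = center φ x n + α • ∑ j, mass φ n j • (xt n j - x n j) := by
  rw [center, h.x_succ, h.sum_mass_smul_act, center, smul_sum, ← sum_add_distrib]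
  refine sum_congr rfl fun j _ => ?_
  simp only [Pi.add_apply, Pi.smul_apply, Pi.sub_apply, smul_add]
  rw [smul_comm]

/-- The weighted average of the `y` variables tracks the average gradient. -/
lemma sum_mass_smul_y (n : ℕ) :
    (I : ℝ) • ∑ i, mass φ n i • y n i = ∑ i, gradient (P.f i) (x n i) := by
  induction n with
  | zero =>
    rw [smul_sum]
    refine sum_congr rfl fun i _ => ?_
    rw [mass, h.run.φ_zero, h.run.y_zero, smul_smul, mul_one_div_cancel h.cast_pos.ne', one_smul]
  | succ n ih =>
    have e : ∀ i, mass φ (n + 1) i • ((1 / φ (n + 1) i) •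
        (gradient (P.f i) (x (n + 1) i) - gradient (P.f i) (x n i)))
        = (1 / (I : ℝ)) • (gradient (P.f i) (x (n + 1) i) - gradient (P.f i) (x n i)) := by
      intro i
      rw [smul_smul, mass]
      congr 1
      have := (h.phi_pos (n + 1) i).ne'
      field_simp
    rw [h.y_succ]
    simp_rw [Pi.add_apply, smul_add, sum_add_distrib, e]
    rw [h.sum_mass_smul_act, smul_add, ih, ← smul_sum, smul_smul,
      mul_one_div_cancel h.cast_pos.ne', one_smul, sum_sub_distrib]
    abel

/-- Disagreement of the copies and of the trackers bounds the gradient error of agent `i`. -/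
lemma norm_gradient_error_le (n : ℕ) {z : Vec m} (hz : z ∈ P.K) {d : ℝ}
    (hd : ∀ i, ‖x n i - z‖ ≤ d) (i : Fin I) :
    ‖P.smoothGradient z - ((I : ℝ) • y n i - gradient P.Gm (x n i))‖
      ≤ Lsum L * d + I * ‖dev (mass φ n) (y n) i‖ + LG * ‖x n i - z‖ := by
  have e : P.smoothGradient z - ((I : ℝ) • y n i - gradient P.Gm (x n i))
      = (∑ i, gradient (P.f i) z - ∑ i, gradient (P.f i) (x n i))
        - (I : ℝ) • dev (mass φ n) (y n) i + (gradient P.Gm (x n i) - gradient P.Gm z) := by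
    rw [dev, smul_sub, h.sum_mass_smul_y, Problem.smoothGradient]
    abel
  rw [e]
  refine (norm_add_le _ _).trans (add_le_add ((norm_sub_le _ _).trans (add_le_add
    (h.standing.norm_sum_gradient_sub_le hz (h.x_mem n) hd) ?_))
    (h.standing.Gm_lipschitz.norm_sub_le (h.x_mem n i) hz))
  rw [norm_smul, Real.norm_of_nonneg h.cast_pos.le]

lemma mass_le (n : ℕ) (i : Fin I) : mass φ n i ≤ ub / I :=
  div_le_div_of_nonneg_right (h.le_ub n i) h.cast_pos.le

lemma ub_pos : 0 < ub := (h.phi_pos 0 ⟨0, h.one_le⟩).trans_le (h.le_ub 0 _)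

lemma cTau_pos : 0 < cTau τ := by
  have : Nonempty (Fin I) := ⟨⟨0, h.one_le⟩⟩
  obtain ⟨i, hi⟩ := exists_eq_ciInf_of_finite (f := τ)
  rw [cTau, ← hi]
  exact h.surrogate.τ_pos i

lemma norm_sum_mass_smul_sq_le (n : ℕ) (v : Fin I → Vec m) :
    ‖∑ j, mass φ n j • v j‖ ^ 2 ≤ ub / I * stackNorm v ^ 2 := by
  have h1 : ‖∑ j, mass φ n j • v j‖ ≤ ∑ j, mass φ n j * ‖v j‖ :=
    norm_sum_le_of_le _ fun j _ => by
      rw [norm_smul, Real.norm_of_nonneg (h.mass_nonneg n j)]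
  have h2 := wVar_nonneg (h.mass_nonneg n) (h.sum_mass n) fun j => ‖v j‖
  rw [wVar, sub_nonneg] at h2
  refine ((pow_le_pow_left₀ (norm_nonneg _) h1 2).trans h2).trans ?_
  rw [stackNorm_sq, mul_sum]
  exact sum_le_sum fun j _ => mul_le_mul_of_nonneg_right (h.mass_le n j) (sq_nonneg _)

lemma sum_mass_mul_Gp_succ_le (n : ℕ) :
    ∑ i, mass φ (n + 1) i * P.Gp (x (n + 1) i)
      ≤ ∑ j, mass φ n j * P.Gp (x n j) + α * ∑ j, mass φ n j * (P.Gp (xt n j) - P.Gp (x n j)) := by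
  have h1 : ∀ i, P.Gp (x (n + 1) i)
      ≤ ∑ j, ratioWeights A φ n i j * P.Gp ((x n + α • (xt n - x n)) j) := by
    intro i
    rw [h.x_succ]
    exact h.standing.Gp_convex.map_sum_le (fun j _ => h.ratioWeights_nonneg n i j)
      (h.weights_row_sum n i) fun j _ => h.moved_mem (h.x_mem n j)
  have h2 : ∀ j, P.Gp ((x n + α • (xt n - x n)) j)
      ≤ P.Gp (x n j) + α * (P.Gp (xt n j) - P.Gp (x n j)) := by
    intro j
    have := h.standing.Gp_convex.2 (h.x_mem n j) (h.xt_mem n j) (sub_nonneg.2 h.step_le)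
      h.step_pos.le (by ring)
    rw [show (1 - α) • x n j + α • xt n j = (x n + α • (xt n - x n)) j by
      simp only [Pi.add_apply, Pi.smul_apply, Pi.sub_apply]; module] at this
    simp only [smul_eq_mul] at this
    linarith
  calc ∑ i, mass φ (n + 1) i * P.Gp (x (n + 1) i)
      ≤ ∑ i, mass φ (n + 1) i *
          ∑ j, ratioWeights A φ n i j * P.Gp ((x n + α • (xt n - x n)) j) :=
        sum_le_sum fun i _ => mul_le_mul_of_nonneg_left (h1 i) (h.mass_nonneg _ _)
    _ = ∑ j, mass φ n j * P.Gp ((x n + α • (xt n - x n)) j) := by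
        simp_rw [mul_sum, ← mul_assoc]
        rw [sum_comm]
        simp_rw [← sum_mul, h.sum_mass_mul]
    _ ≤ ∑ j, mass φ n j * (P.Gp (x n j) + α * (P.Gp (xt n j) - P.Gp (x n j))) :=
        sum_le_sum fun j _ => mul_le_mul_of_nonneg_left (h2 j) (h.mass_nonneg _ _)
    _ = _ := by
        rw [mul_sum, ← sum_add_distrib]
        exact sum_congr rfl fun j _ => by ring

/-- Descent of the Lyapunov function, up to the disagreement of the copies and of the
trackers. -/
lemma lyapunov_succ_le (n : ℕ) :
    lyapunov P φ x (n + 1) ≤ lyapunov P φ x n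
      - (α * (lb / I * cTau τ) - α ^ 2 * ((Lsum L + LG) / 2 * (ub / I)))
          * stackNorm (xt n - x n) ^ 2
      + α * (ub * ((Lsum L * √I + LG) / I * (stackNorm (dev (mass φ n) (x n))
            * stackNorm (xt n - x n))
          + stackNorm (dev (mass φ n) (y n)) * stackNorm (xt n - x n))) := by
  set Δ := xt n - x n with hΔ
  set δ := stackNorm Δ with hδ
  set E := stackNorm (dev (mass φ n) (x n)) with hE
  set Ey := stackNorm (dev (mass φ n) (y n)) with hEy
  set z := center φ x n with hz
  have hI := h.cast_pos
  have hα := h.step_pos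
  have hzK : z ∈ P.K := h.center_mem n
  have hL0 : 0 ≤ Lsum L := sum_nonneg fun i _ => (L i).coe_nonneg
  have hdesc := le_add_inner_add_of_lipschitzOnWith h.standing.convex
    (fun w hw => h.standing.hasGradientAt_smooth hw)
    (fun w hw v hv => h.standing.norm_smoothGradient_sub_le hw hv) hzK (h.center_mem (n + 1))
  rw [h.center_succ, add_sub_cancel_left, norm_smul, Real.norm_of_nonneg hα.le, mul_pow,
    inner_smul_right, inner_sum, ← h.center_succ] at hdesc
  simp_rw [inner_smul_right] at hdesc
  have hG := h.sum_mass_mul_Gp_succ_le n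
  have hquad := h.norm_sum_mass_smul_sq_le n Δ
  have hlin : ∑ j, mass φ n j * inner ℝ (P.smoothGradient z) (Δ j)
        + ∑ j, mass φ n j * (P.Gp (xt n j) - P.Gp (x n j))
      ≤ ∑ j, mass φ n j * (Lsum L * E + I * ‖dev (mass φ n) (y n) j‖
          + LG * ‖dev (mass φ n) (x n) j‖) * ‖Δ j‖
        - ∑ j, mass φ n j * (τ j * ‖Δ j‖ ^ 2) := by
    rw [← sum_add_distrib, ← sum_sub_distrib]
    refine sum_le_sum fun j _ => ?_
    rw [← mul_add, mul_assoc, ← mul_sub]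
    refine mul_le_mul_of_nonneg_left ?_ (h.mass_nonneg n j)
    have h1 := inner_direction_le h.standing h.surrogate (h.x_mem n j) (h.run.xt_argmin n j)
    have h2 := h.norm_gradient_error_le n hzK
      (fun i => norm_le_stackNorm (dev (mass φ n) (x n)) i) j
    have h3 := (real_inner_le_norm
      (P.smoothGradient z - ((I : ℝ) • y n j - gradient P.Gm (x n j))) (Δ j)).trans
      (mul_le_mul_of_nonneg_right h2 (norm_nonneg _))
    rw [inner_sub_left] at h3
    change inner ℝ ((I : ℝ) • y n j - gradient P.Gm (x n j)) (Δ j) + _ ≤ -(τ j * ‖Δ j‖ ^ 2) at h1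
    change _ ≤ (Lsum L * E + I * ‖dev (mass φ n) (y n) j‖
          + LG * ‖dev (mass φ n) (x n) j‖) * ‖Δ j‖ at h3
    linarith
  have hcross : ∑ j, mass φ n j * (Lsum L * E + I * ‖dev (mass φ n) (y n) j‖
          + LG * ‖dev (mass φ n) (x n) j‖) * ‖Δ j‖
      ≤ ub * ((Lsum L * √I + LG) / I * (E * δ) + Ey * δ) := by
    have h1 : ∑ j, ‖Δ j‖ ≤ √I * δ := by
      have := sum_le_sqrt_card_mul_l2 univ fun j => ‖Δ j‖
      rwa [card_univ, Fintype.card_fin] at this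
    have h2 : ∑ j, ‖dev (mass φ n) (y n) j‖ * ‖Δ j‖ ≤ Ey * δ := sum_mul_le_l2_mul_l2 _ _ _
    have h3 : ∑ j, ‖dev (mass φ n) (x n) j‖ * ‖Δ j‖ ≤ E * δ := sum_mul_le_l2_mul_l2 _ _ _
    have hE0 : 0 ≤ E := stackNorm_nonneg _
    calc _ ≤ ∑ j, ub / I * (Lsum L * E * ‖Δ j‖ + I * (‖dev (mass φ n) (y n) j‖ * ‖Δ j‖)
          + LG * (‖dev (mass φ n) (x n) j‖ * ‖Δ j‖)) := by
          refine sum_le_sum fun j _ => ?_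
          rw [mul_assoc]
          refine (mul_le_mul_of_nonneg_right (h.mass_le n j) (by positivity)).trans_eq ?_
          ring
      _ = ub / I * (Lsum L * E * ∑ j, ‖Δ j‖ + I * ∑ j, ‖dev (mass φ n) (y n) j‖ * ‖Δ j‖
          + LG * ∑ j, ‖dev (mass φ n) (x n) j‖ * ‖Δ j‖) := by
          simp_rw [← mul_sum, sum_add_distrib, ← mul_sum]
      _ ≤ ub / I * (Lsum L * E * (√I * δ) + I * (Ey * δ) + LG * (E * δ)) := by
          have := h.ub_pos
          gcongr
      _ = _ := by field_simp; ring
  have htau : lb / I * cTau τ * δ ^ 2 ≤ ∑ j, mass φ n j * (τ j * ‖Δ j‖ ^ 2) := by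
    rw [hδ, stackNorm_sq, mul_sum]
    refine sum_le_sum fun j _ => ?_
    rw [mul_assoc]
    have := h.cTau_pos
    exact mul_le_mul (div_le_div_of_nonneg_right (h.lb_le n j) hI.le)
      (mul_le_mul_of_nonneg_right (cTau_le τ j) (sq_nonneg _)) (by positivity) (h.mass_nonneg n j)
  have h1 := mul_le_mul_of_nonneg_left (hlin.trans (sub_le_sub hcross htau)) hα.le
  have h2 : (Lsum L + LG) / 2 * (α ^ 2 * ‖∑ j, mass φ n j • Δ j‖ ^ 2)
      ≤ (Lsum L + LG) / 2 * (α ^ 2 * (ub / I * δ ^ 2)) := by gcongr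
  simp only [lyapunov]
  change _ ≤ _ + α * ∑ j, mass φ n j * inner ℝ (P.smoothGradient z) (Δ j)
    + (Lsum L + LG) / 2 * (α ^ 2 * ‖∑ j, mass φ n j • Δ j‖ ^ 2) at hdesc
  linarith

lemma U_center_le_lyapunov (n : ℕ) : P.U (center φ x n) ≤ lyapunov P φ x n := by
  have := h.standing.Gp_convex.map_sum_le (fun j _ => h.mass_nonneg n j) (h.sum_mass n)
    fun j _ => h.x_mem n j
  simp only [smul_eq_mul] at this
  change P.Gp (center φ x n) ≤ _ at this
  rw [Problem.U, lyapunov]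
  linarith

/-- The merit function is controlled by the two disagreements and the size of the local
directions. -/
lemma M_le (n : ℕ) :
    M P (x n) ≤ ((2 + I + 2 * Lsum L + LG + Lsum Lt) * (stackNorm (dev (mass φ n) (x n))
      + stackNorm (dev (mass φ n) (y n)) + stackNorm (xt n - x n))) ^ 2 := by
  set E := stackNorm (dev (mass φ n) (x n))
  set Ey := stackNorm (dev (mass φ n) (y n))
  set δ := stackNorm (xt n - x n)
  have hE : 0 ≤ E := stackNorm_nonneg _
  have hEy : 0 ≤ Ey := stackNorm_nonneg _
  have hδ : 0 ≤ δ := stackNorm_nonneg _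
  have hI := h.cast_pos
  have hL0 : 0 ≤ Lsum L := sum_nonneg fun i _ => (L i).coe_nonneg
  have hLt0 : 0 ≤ Lsum Lt := sum_nonneg fun i _ => (Lt i).coe_nonneg
  have hDE : D (x n) ≤ E := D_le _ _
  have hxz : ∀ i, ‖x n i - avg (x n)‖ ≤ E := fun i =>
    (norm_le_stackNorm (fun i => x n i - avg (x n)) i).trans hDE
  have hz := avg_mem h.standing.convex h.one_le (h.x_mem n)
  set z := avg (x n)
  set i : Fin I := ⟨0, h.one_le⟩
  have hΔ : ‖xt n i - x n i‖ ≤ δ := norm_le_stackNorm (xt n - x n) i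
  have hLi : (L i : ℝ) ≤ Lsum L :=
    single_le_sum (f := fun i => (L i : ℝ)) (fun i _ => (L i).coe_nonneg) (mem_univ i)
  have hLti : (Lt i : ℝ) ≤ Lsum Lt :=
    single_le_sum (f := fun i => (Lt i : ℝ)) (fun i _ => (Lt i).coe_nonneg) (mem_univ i)
  have hJ := norm_sub_le_of_variational (h.standing.isArgmin_stationarityPoint hz).1 (h.xt_mem n i)
    (fun w hw => h.standing.stationarityPoint_variational hz hw)
    (fun w hw => localModel_variational h.standing h.surrogate (h.x_mem n i)
      (h.run.xt_argmin n i) hw)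
  have e : P.smoothGradient z - (gft i (xt n i) (x n i) - gradient P.Gm (x n i)
        + ((I : ℝ) • y n i - gradient (P.f i) (x n i)))
      = (P.smoothGradient z - ((I : ℝ) • y n i - gradient P.Gm (x n i)))
        - (gft i (xt n i) (x n i) - gft i (xt n i) (xt n i))
        - (gradient (P.f i) (xt n i) - gradient (P.f i) (x n i)) := by
    rw [h.surrogate.gradient_diag i _ (h.xt_mem n i)]
    abel
  rw [e] at hJ
  have h1 := h.norm_gradient_error_le n hz hxz i
  have h2 := (h.surrogate.gradient_lipschitz i _ (h.xt_mem n i)).norm_sub_le (h.x_mem n i)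
    (h.xt_mem n i)
  have h3 := (h.standing.f_lipschitz i).norm_sub_le (h.xt_mem n i) (h.x_mem n i)
  rw [norm_sub_rev (x n i)] at h2
  have h4 : ‖xt n i - z‖ ≤ δ + E := by
    have := norm_add_le (xt n i - x n i) (x n i - z)
    rw [sub_add_sub_cancel] at this
    linarith [hxz i]
  have h5 := norm_sub_le ((P.smoothGradient z - ((I : ℝ) • y n i - gradient P.Gm (x n i)))
        - (gft i (xt n i) (x n i) - gft i (xt n i) (xt n i)))
        (gradient (P.f i) (xt n i) - gradient (P.f i) (x n i))
  have h6 := norm_sub_le (P.smoothGradient z - ((I : ℝ) • y n i - gradient P.Gm (x n i)))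
        (gft i (xt n i) (x n i) - gft i (xt n i) (xt n i))
  have h7 : (I : ℝ) * ‖dev (mass φ n) (y n) i‖ ≤ I * Ey :=
    mul_le_mul_of_nonneg_left (norm_le_stackNorm _ i) hI.le
  have h8 : (LG : ℝ) * ‖x n i - z‖ ≤ LG * E := mul_le_mul_of_nonneg_left (hxz i) LG.coe_nonneg
  have h9 : (Lt i : ℝ) * ‖xt n i - x n i‖ ≤ Lsum Lt * δ :=
    mul_le_mul hLti hΔ (norm_nonneg _) hLt0
  have h10 : (L i : ℝ) * ‖xt n i - x n i‖ ≤ Lsum L * δ :=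
    mul_le_mul hLi hΔ (norm_nonneg _) hL0
  have hJ' : P.J z ≤ 2 * (δ + E) + (Lsum L * E + I * Ey + LG * E + Lsum Lt * δ + Lsum L * δ) := by
    rw [Problem.J]
    linarith
  have hLG := LG.coe_nonneg
  set R := 2 + (I : ℝ) + 2 * Lsum L + LG + Lsum Lt with hR
  have hb1 : P.J z ≤ R * (E + Ey + δ) := by
    refine hJ'.trans ?_
    rw [hR, ← sub_nonneg]
    have : 0 ≤ Lsum L * E + Lsum Lt * E + I * E + (2 + 2 * Lsum L + LG + Lsum Lt) * Ey
      + (I + LG + Lsum L) * δ := by positivity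
    linarith
  have hb2 : D (x n) ≤ R * (E + Ey + δ) := by
    refine hDE.trans ?_
    have : 1 ≤ R := by rw [hR]; linarith
    nlinarith
  exact max_le (pow_le_pow_left₀ (norm_nonneg _) hb1 2)
    (pow_le_pow_left₀ (Real.sqrt_nonneg _) hb2 2)

end IsBoundedRun

end Iteration

/-! ### Summability of the merit function -/

section Summability

variable {I m : ℕ}

lemma le_max_of_quadratic_le {p q w s : ℝ} (hp : 0 < p) (hw : 0 ≤ w)
    (h : p * s ^ 2 ≤ q * s + w) : s ≤ max 1 ((q + w) / p) := by
  by_contra! hs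
  have h1 : 1 < s := (le_max_left _ _).trans_lt hs
  have h2 : (q + w) / p < s := (le_max_right _ _).trans_lt hs
  rw [div_lt_iff₀ hp] at h2
  nlinarith

lemma Lmx_nonneg (L : Fin I → ℝ≥0) : 0 ≤ Lmx L := Real.iSup_nonneg fun i => (L i).coe_nonneg

lemma le_Lmx (L : Fin I → ℝ≥0) (i : Fin I) : (L i : ℝ) ≤ Lmx L :=
  le_ciSup (f := fun i => (L i : ℝ)) (Set.finite_range _).bddAbove i

lemma Lsum_nonneg (L : Fin I → ℝ≥0) : 0 ≤ Lsum L := sum_nonneg fun i _ => (L i).coe_nonneg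

namespace IsBoundedRun

variable {P : Problem I m} {L : Fin I → ℝ≥0} {LG : ℝ≥0} {ft : Fin I → Vec m → Vec m → ℝ}
  {gft : Fin I → Vec m → Vec m → Vec m} {τ : Fin I → ℝ} {Lt : Fin I → ℝ≥0}
  {A : ℕ → Matrix (Fin I) (Fin I) ℝ} {α : ℝ} {x xt y : ℕ → Fin I → Vec m} {φ : ℕ → Fin I → ℝ}
  {lb ub : ℝ} {b : ℕ} {r c ω : ℝ}

variable (h : IsBoundedRun P L LG ft gft τ Lt A α x xt y φ lb ub)

include h

/-- The disagreement of the copies has finite `ℓ²` gain with respect to the local directions. -/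
lemma exists_l2_dev_x_le (hmix : IsMixing m (ratioWeights A φ) (mass φ) b r c ω) (hr0 : 0 ≤ r)
    (hr1 : r < 1) (hc : 0 ≤ c) (hω : 0 ≤ ω) :
    ∃ k, ∀ N, l2 (range N) (fun n => stackNorm (dev (mass φ n) (x n)))
      ≤ k + α * (c * ω * (b / (1 - r))) * l2 (range N) (fun n => stackNorm (xt n - x n)) := by
  refine ⟨_, fun N => (hmix.l2_dev_le hr0 hr1 hc h.x_succ_eq_add N).trans
    (add_le_add_right ?_ _)⟩
  have h0 : 0 ≤ c * b / (1 - r) := div_nonneg (by positivity) (by linarith)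
  have h1 : l2 (range N) (fun n => stackNorm (α • act (ratioWeights A φ n) (xt n - x n)))
      ≤ α * (ω * l2 (range N) (fun n => stackNorm (xt n - x n))) := by
    simp_rw [stackNorm_smul h.step_pos.le]
    rw [l2_const_mul _ h.step_pos.le, ← l2_const_mul _ hω]
    exact mul_le_mul_of_nonneg_left
      (l2_mono (fun n _ => stackNorm_nonneg _) fun n _ => hmix.step n _) h.step_pos.le
  refine (mul_le_mul_of_nonneg_left h1 h0).trans_eq ?_
  ring

lemma stackNorm_x_succ_sub_le (hmix : IsMixing m (ratioWeights A φ) (mass φ) b r c ω) (n : ℕ) :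
    stackNorm (x (n + 1) - x n)
      ≤ (ω + 1) * stackNorm (dev (mass φ n) (x n)) + α * ω * stackNorm (xt n - x n) := by
  have hd : dev (mass φ n) (x n) = x n - fun _ => center φ x n := rfl
  have e : x (n + 1) - x n = act (ratioWeights A φ n) (dev (mass φ n) (x n))
      - dev (mass φ n) (x n) + α • act (ratioWeights A φ n) (xt n - x n) := by
    rw [h.x_succ_eq_add, hd, act_sub _ (x n) fun _ => center φ x n, act_const (h.weights_row_sum n)]
    abel
  rw [e]
  have h1 := stackNorm_add_le (act (ratioWeights A φ n) (dev (mass φ n) (x n))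
      - dev (mass φ n) (x n)) (α • act (ratioWeights A φ n) (xt n - x n))
  have h2 := stackNorm_sub_le (act (ratioWeights A φ n) (dev (mass φ n) (x n)))
    (dev (mass φ n) (x n))
  rw [stackNorm_smul h.step_pos.le] at h1
  have h3 := hmix.step n (dev (mass φ n) (x n))
  have h4 := mul_le_mul_of_nonneg_left (hmix.step n (xt n - x n)) h.step_pos.le
  linarith

/-- The disagreement of the trackers has finite `ℓ²` gain with respect to the disagreement of the
copies and the local directions. -/
lemma exists_l2_dev_y_le (hmix : IsMixing m (ratioWeights A φ) (mass φ) b r c ω) (hr0 : 0 ≤ r)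
    (hr1 : r < 1) (hc : 0 ≤ c) (hω : 0 ≤ ω) :
    ∃ k, ∀ N, l2 (range N) (fun n => stackNorm (dev (mass φ n) (y n)))
      ≤ k + c * (b / (1 - r)) * (lb⁻¹ * Lmx L)
        * ((ω + 1) * l2 (range N) (fun n => stackNorm (dev (mass φ n) (x n)))
          + α * ω * l2 (range N) (fun n => stackNorm (xt n - x n))) := by
  refine ⟨_, fun N => (hmix.l2_dev_le hr0 hr1 hc h.y_succ N).trans
    (add_le_add_right ?_ _)⟩
  have h0 : 0 ≤ c * b / (1 - r) := div_nonneg (by positivity) (by linarith)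
  have hα := h.step_pos
  have hl : 0 ≤ lb⁻¹ * Lmx L := mul_nonneg (inv_nonneg.2 h.lb_pos.le) (Lmx_nonneg L)
  rw [← mul_div_assoc c, mul_assoc (c * b / (1 - r))]
  refine mul_le_mul_of_nonneg_left ?_ h0
  rw [← l2_const_mul _ (by positivity : 0 ≤ ω + 1), ← l2_const_mul _ (by positivity : 0 ≤ α * ω)]
  have h2 : l2 (range N) (fun n => stackNorm fun i =>
        (1 / φ (n + 1) i) • (gradient (P.f i) (x (n + 1) i) - gradient (P.f i) (x n i)))
      ≤ l2 (range N) (fun n => lb⁻¹ * Lmx L * ((ω + 1) * stackNorm (dev (mass φ n) (x n))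
        + α * ω * stackNorm (xt n - x n))) := by
    refine l2_mono (fun n _ => stackNorm_nonneg _) fun n _ => ?_
    refine le_trans ?_ (mul_le_mul_of_nonneg_left (h.stackNorm_x_succ_sub_le hmix n) hl)
    refine stackNorm_le_mul hl fun i => ?_
    rw [norm_smul, mul_assoc, Real.norm_of_nonneg (one_div_nonneg.2 (h.phi_pos _ _).le), one_div]
    refine mul_le_mul (inv_anti₀ h.lb_pos (h.lb_le _ _)) ?_ (norm_nonneg _)
      (inv_nonneg.2 h.lb_pos.le)
    exact ((h.standing.f_lipschitz i).norm_sub_le (h.x_mem _ i) (h.x_mem _ i)).trans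
      (mul_le_mul_of_nonneg_right (le_Lmx L i) (norm_nonneg _))
  rw [l2_const_mul _ hl] at h2
  exact h2.trans (mul_le_mul_of_nonneg_left (l2_add_le _ _ _) hl)

/-- If the `ℓ²` gains `gx` and `gy` of the two disagreements leave a positive margin in the descent
inequality, the merit function is summable along the run. -/
lemma exists_sum_M_le {gx gy kx ky : ℝ} (hgx : 0 ≤ gx) (hgy : 0 ≤ gy)
    (hx : ∀ N, l2 (range N) (fun n => stackNorm (dev (mass φ n) (x n)))
      ≤ kx + gx * l2 (range N) (fun n => stackNorm (xt n - x n)))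
    (hy : ∀ N, l2 (range N) (fun n => stackNorm (dev (mass φ n) (y n)))
      ≤ ky + gy * l2 (range N) (fun n => stackNorm (xt n - x n)))
    (hmargin : 0 < lb / I * cTau τ - α * ((Lsum L + LG) / 2 * (ub / I))
      - ub * ((Lsum L * √I + LG) / I * gx + gy)) :
    ∃ C, ∀ N, ∑ n ∈ range N, M P (x n) ≤ C := by
  obtain ⟨u, hu⟩ := h.standing.U_bddBelow
  have hu' : ∀ n, u ≤ lyapunov P φ x n := fun n =>
    (hu ⟨_, h.center_mem n, rfl⟩).trans (h.U_center_le_lyapunov n)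
  have hα := h.step_pos
  have hub := h.ub_pos
  have hL := Lsum_nonneg L
  have hLt := Lsum_nonneg Lt
  set a := (Lsum L * √I + LG) / I with ha
  have ha0 : 0 ≤ a := by positivity
  set p := lb / I * cTau τ - α * ((Lsum L + LG) / 2 * (ub / I)) - ub * (a * gx + gy) with hp
  set S : ℕ → ℝ := fun N => l2 (range N) (fun n => stackNorm (xt n - x n)) with hS
  have hS0 : ∀ N, 0 ≤ S N := fun N => l2_nonneg _ _
  have hsum : ∀ N, lyapunov P φ x N ≤ lyapunov P φ x 0
      - (α * (lb / I * cTau τ) - α ^ 2 * ((Lsum L + LG) / 2 * (ub / I))) * S N ^ 2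
      + α * (ub * (a * ∑ n ∈ range N, stackNorm (dev (mass φ n) (x n)) * stackNorm (xt n - x n)
          + ∑ n ∈ range N, stackNorm (dev (mass φ n) (y n)) * stackNorm (xt n - x n))) := by
    intro N
    simp only [hS, l2_sq]
    induction N with
    | zero => simp
    | succ N ih =>
      have := h.lyapunov_succ_le N
      simp only [sum_range_succ]
      linarith
  have hbound : ∀ N, S N
      ≤ max 1 ((α * (ub * (a * kx + ky)) + (lyapunov P φ x 0 - u)) / (α * p)) := by
    intro N
    refine le_max_of_quadratic_le (mul_pos hα hmargin) (sub_nonneg.2 (hu' 0)) ?_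
    have h1 := (sum_mul_le_l2_mul_l2 (range N) (fun n => stackNorm (dev (mass φ n) (x n)))
      (fun n => stackNorm (xt n - x n))).trans (mul_le_mul_of_nonneg_right (hx N) (hS0 N))
    have h2 := (sum_mul_le_l2_mul_l2 (range N) (fun n => stackNorm (dev (mass φ n) (y n)))
      (fun n => stackNorm (xt n - x n))).trans (mul_le_mul_of_nonneg_right (hy N) (hS0 N))
    have h3 : α * (ub * (a * ∑ n ∈ range N,
            stackNorm (dev (mass φ n) (x n)) * stackNorm (xt n - x n)
          + ∑ n ∈ range N, stackNorm (dev (mass φ n) (y n)) * stackNorm (xt n - x n)))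
        ≤ α * (ub * (a * ((kx + gx * S N) * S N) + (ky + gy * S N) * S N)) := by
      gcongr
    have h4 := hsum N
    have h5 := hu' N
    rw [hp]
    linarith
  set S₀ := max 1 ((α * (ub * (a * kx + ky)) + (lyapunov P φ x 0 - u)) / (α * p))
  set R := 2 + (I : ℝ) + 2 * Lsum L + LG + Lsum Lt with hR
  have hR0 : 0 ≤ R := by positivity
  refine ⟨(R * ((kx + gx * S₀) + (ky + gy * S₀) + S₀)) ^ 2, fun N => ?_⟩
  refine (sum_le_sum fun n _ => h.M_le n).trans ?_
  rw [← l2_sq, l2_const_mul _ hR0]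
  refine pow_le_pow_left₀ (mul_nonneg hR0 (l2_nonneg _ _)) (mul_le_mul_of_nonneg_left ?_ hR0) 2
  refine (l2_add_le _ _ _).trans (add_le_add ((l2_add_le _ _ _).trans (add_le_add ?_ ?_))
    (hbound N))
  · exact (hx N).trans (add_le_add_right (mul_le_mul_of_nonneg_left (hbound N) hgx) _)
  · exact (hy N).trans (add_le_add_right (mul_le_mul_of_nonneg_left (hbound N) hgy) _)

/-- The step-size bound leaves a positive margin. The factor `√(2 / (1 - σ²)) > 1` makes
the margin strict, except when `cL = 0`; then all the error terms vanish. -/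
lemma exists_sum_M_le_of_isMixing {c' σ : ℝ}
    (hmix : IsMixing m (ratioWeights A φ) (mass φ) b r c' ω) (hr0 : 0 ≤ r) (hr1 : r < 1)
    (hb : 1 ≤ b) (hc' : 0 ≤ c') (hω : 1 ≤ ω) (hcω : c' * ω ≤ c) (hc : 1 ≤ c)
    (hσ : σ ∈ Set.Ioo (0 : ℝ) 1) (hstep : StepBound L Lt LG τ σ c b lb ub r α) :
    ∃ C, ∀ N, ∑ n ∈ range N, M P (x n) ≤ C := by
  obtain ⟨kx, hx⟩ := h.exists_l2_dev_x_le hmix hr0 hr1 hc' (by linarith)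
  obtain ⟨ky, hy⟩ := h.exists_l2_dev_y_le hmix hr0 hr1 hc' (by linarith)
  have hα := h.step_pos
  have hI := h.cast_pos
  have hub := h.ub_pos
  have hlb := inv_pos.2 h.lb_pos
  have hL := Lsum_nonneg L
  have hLm := Lmx_nonneg L
  have hLtm := Lmx_nonneg Lt
  have hLG := LG.coe_nonneg
  have hb1 : (1 : ℝ) ≤ b := by exact_mod_cast hb
  set β := (b : ℝ) / (1 - r) with hβ
  have hβ1 : 1 ≤ β := by rw [hβ, one_le_div (by linarith)]; linarith
  set gx := α * (c' * ω * β) with hgx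
  have hgx0 : 0 ≤ gx := by positivity
  set gy := c' * β * (lb⁻¹ * Lmx L) * ((ω + 1) * gx + α * ω) with hgy
  have hgy0 : 0 ≤ gy := by positivity
  refine h.exists_sum_M_le (kx := kx) (ky := ky + c' * β * (lb⁻¹ * Lmx L) * ((ω + 1) * kx))
    hgx0 hgy0 hx (fun N => ?_) ?_
  · refine (hy N).trans ?_
    have h1 := mul_le_mul_of_nonneg_left (hx N)
      (by positivity : 0 ≤ c' * β * (lb⁻¹ * Lmx L) * (ω + 1))
    rw [hgy]
    linarith
  · obtain ⟨-, hstep⟩ := hstep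
    have hσ1 : 0 < 1 - σ ^ 2 := by nlinarith [hσ.1, hσ.2]
    have hσ2 : 1 < 1 / (1 - σ ^ 2) := by
      rw [one_lt_div hσ1]; nlinarith [hσ.1]
    have hs1 : 1 ≤ √(1 / (1 - σ ^ 2)) := Real.one_le_sqrt.2 hσ2.le
    have hs2 : 1 < √(2 / (1 - σ ^ 2)) := by
      rw [Real.lt_sqrt zero_le_one, show 2 / (1 - σ ^ 2) = 2 * (1 / (1 - σ ^ 2)) by ring]
      linarith
    set s1 := √(1 / (1 - σ ^ 2))
    set s2 := √(2 / (1 - σ ^ 2))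
    set a := (Lsum L * √I + LG) / I with ha
    have hcL : a ≤ cL L Lt LG := by
      rw [ha, cL]
      exact div_le_div_of_nonneg_right (by linarith) hI.le
    have ha0 : 0 ≤ a := by positivity
    have hgx1 : gx ≤ α * (c * β) := by rw [hgx]; gcongr
    have hgy1 : gy ≤ α * (3 * (lb⁻¹ * Lmx L) * (c * β) ^ 2) := by
      have hcβ : 1 ≤ c * β := by nlinarith
      have h1 : (ω + 1) * gx + α * ω ≤ 3 * ω * (α * (c * β)) := by
        have h2 : (ω + 1) * gx ≤ 2 * ω * (α * (c * β)) :=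
          mul_le_mul (by linarith) hgx1 hgx0 (by linarith)
        have h3 : α * ω * 1 ≤ α * ω * (c * β) :=
          mul_le_mul_of_nonneg_left hcβ (by positivity)
        linarith
      calc gy ≤ c' * β * (lb⁻¹ * Lmx L) * (3 * ω * (α * (c * β))) :=
            mul_le_mul_of_nonneg_left h1 (by positivity)
        _ = (c' * ω) * (β * (lb⁻¹ * Lmx L) * (3 * (α * (c * β)))) := by ring
        _ ≤ c * (β * (lb⁻¹ * Lmx L) * (3 * (α * (c * β)))) :=
            mul_le_mul_of_nonneg_right hcω (by positivity)
        _ = _ := by ring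
    -- the margin, normalized as in the step-size bound
    suffices hsuff : 0 < 2 * cTau τ * lb / (I * ub) - α * ((Lsum L + LG) / I)
        - 2 * (a * gx) - 2 * gy by
      have e : lb / I * cTau τ - α * ((Lsum L + LG) / 2 * (ub / I)) - ub * (a * gx + gy)
          = ub / 2 * (2 * cTau τ * lb / (I * ub) - α * ((Lsum L + LG) / I)
            - 2 * (a * gx) - 2 * gy) := by
        field_simp
        ring
      rw [e]
      positivity
    rcases (ha0.trans hcL).eq_or_lt' with h0 | hpos
    · rw [cL, div_eq_zero_iff, or_iff_left hI.ne'] at h0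
      have hLs : 0 ≤ Lsum L * √I := by positivity
      have hLm0 : Lmx L = 0 := by linarith
      have hLG0 : (LG : ℝ) = 0 := by linarith
      have hLs0 : Lsum L = 0 := by
        have : Lsum L * √I = 0 := by linarith
        exact (mul_eq_zero.1 this).resolve_right (Real.sqrt_pos.2 hI).ne'
      have := h.cTau_pos
      have := h.lb_pos
      rw [hgy, ha, hLm0, hLG0, hLs0]
      simp
      positivity
    · have h1 : a * gx ≤ cL L Lt LG * (α * (c * β)) := mul_le_mul hcL hgx1 hgx0 hpos.le
      have hβ2 : (b : ℝ) ^ 2 * c ^ 2 / (1 - r) ^ 2 = (c * β) ^ 2 := by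
        rw [hβ, ← mul_div_assoc, div_pow, mul_pow, mul_comm]
      have e : α * ((Lsum L + LG) / I + 2 * cL L Lt LG * b * c / (1 - r) * s2
            + 12 * Lmx L * lb⁻¹ * b ^ 2 * c ^ 2 / (1 - r) ^ 2 * s1)
          = α * ((Lsum L + LG) / I) + 2 * (cL L Lt LG * (α * (c * β))) * s2
            + 12 * (α * ((lb⁻¹ * Lmx L) * (c * β) ^ 2)) * s1 := by
        rw [← hβ2, hβ]
        generalize 1 - r = q
        ring
      rw [e] at hstep
      have h2 : 0 < cL L Lt LG * (α * (c * β)) := by positivity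
      have h3 : 0 ≤ α * ((lb⁻¹ * Lmx L) * (c * β) ^ 2) := by positivity
      have h4 := mul_lt_mul_of_pos_left hs2 h2
      have h5 := mul_le_mul_of_nonneg_left hs1 h3
      linarith

end IsBoundedRun

end Summability

/-! ### The two network regimes -/

section Regimes

variable {I m : ℕ}

lemma step_le_one_of_stepBound {L Lt : Fin I → ℝ≥0} {LG : ℝ≥0} {τ : Fin I → ℝ}
    {σ c lb ub r α : ℝ} {b : ℕ} (hr0 : 0 ≤ r) (hb : 1 ≤ b) (hc : 1 ≤ c)
    (hσ : σ ∈ Set.Ioo (0 : ℝ) 1) (h : StepBound L Lt LG τ σ c b lb ub r α) : α ≤ 1 := by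
  have hb1 : (1 : ℝ) ≤ b := by exact_mod_cast hb
  have h2 : 1 ≤ √(2 : ℝ) := Real.one_le_sqrt.2 one_le_two
  have h3 : 1 ≤ √2 * c * b :=
    one_le_mul_of_one_le_of_one_le (one_le_mul_of_one_le_of_one_le h2 hc) hb1
  refine h.1.trans (div_le_one_of_le₀ ?_ (by linarith))
  nlinarith [hσ.1, hσ.2]

/-- A value of `rhoBar` below `1` forces at least two agents and a positive `Bbar`. -/
lemma pos_of_rhoBar_lt_one {B Bbar : ℕ} {κ : ℝ} (hI : 1 ≤ I) (hκ : 0 < κ)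
    (h : rhoBar I B κ Bbar < 1) : 2 ≤ I ∧ 1 ≤ Bbar := by
  have hI1 : (1 : ℝ) ≤ I := by exact_mod_cast hI
  have hc : 1 ≤ 2 * c0 I B κ := by
    have : 0 ≤ (kappaT I B κ ^ ((I - 1) * B))⁻¹ :=
      inv_nonneg.2 (pow_nonneg (div_nonneg (pow_nonneg hκ.le _) (by linarith)) _)
    rw [c0]; linarith
  have hq : Bbar / ((I - 1) * B) ≠ 0 := by
    intro h0
    rw [rhoBar, h0, pow_zero, mul_one] at h
    exact absurd h (not_lt.2 (one_le_mul_of_one_le_of_one_le hc hI1))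
  constructor
  · by_contra hI2
    obtain rfl : I = 1 := by omega
    simp at hq
  · by_contra hB
    obtain rfl : Bbar = 0 := by omega
    simp at hq

lemma rhoBar_nonneg {B Bbar : ℕ} {κ : ℝ} (hI : 1 ≤ I) (hκ : 0 < κ) (hκ1 : κ ≤ 1) :
    0 ≤ rhoBar I B κ Bbar := by
  have h0 : 0 ≤ kappaT I B κ := div_nonneg (pow_nonneg hκ.le _) (Nat.cast_nonneg _)
  have h1 : 0 ≤ rho I B κ := sub_nonneg.2 (pow_le_one₀ h0 (kappaT_le_one hκ hκ1 hI))
  have h2 : 0 ≤ c0 I B κ := by rw [c0]; positivity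
  rw [rhoBar]
  positivity

variable {P : Problem I m} {L : Fin I → ℝ≥0} {LG : ℝ≥0} {ft : Fin I → Vec m → Vec m → ℝ}
  {gft : Fin I → Vec m → Vec m → Vec m} {τ : Fin I → ℝ} {Lt : Fin I → ℝ≥0}
  {G : ℕ → Digraph (Fin I)} {B : ℕ} {A : ℕ → Matrix (Fin I) (Fin I) ℝ} {κ σ α : ℝ}
  {x xt y : ℕ → Fin I → Vec m} {φ : ℕ → Fin I → ℝ}

lemma exists_sum_M_le_of_columnStochastic (hI : 1 ≤ I) (hP : P.Standing L LG)
    (hG : IsBStronglyConnected G B) (hA : IsCompliant G A κ) (hcol : ColumnStochastic A)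
    (hft : IsSurrogate P ft gft τ Lt) (hσ : σ ∈ Set.Ioo (0 : ℝ) 1) (hα : 0 < α)
    (hrun : IsRun P ft A α x xt y φ) {Bbar : ℕ} (hr : rhoBar I B κ Bbar < 1)
    (hstep : StepBound L Lt LG τ σ (I * √(2 * (I : ℝ))) Bbar (phiLb I B κ) (phiUb I B κ)
      (rhoBar I B κ Bbar) α) :
    ∃ C, ∀ N, ∑ n ∈ range N, M P (x n) ≤ C := by
  obtain ⟨hI2, hB⟩ := pos_of_rhoBar_lt_one hI hA.κ_pos hr
  have hI1 : (1 : ℝ) ≤ I := by exact_mod_cast hI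
  have hr0 := rhoBar_nonneg (B := B) (Bbar := Bbar) hI hA.κ_pos (hA.le_one hcol hI)
  have hc : 1 ≤ I * √(2 * (I : ℝ)) :=
    one_le_mul_of_one_le_of_one_le hI1 (Real.one_le_sqrt.2 (by linarith))
  have h : IsBoundedRun P L LG ft gft τ Lt A α x xt y φ (phiLb I B κ) (phiUb I B κ) :=
    ⟨hI, hP, hft, hrun, hA.nonneg, hcol, phiLb_pos hA.κ_pos,
      phiLb_le_phi hG hA hcol hI hrun.φ_zero hrun.φ_succ,
      phi_le_phiUb hG hA hcol hI2 hrun.φ_zero hrun.φ_succ, hα,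
      step_le_one_of_stepBound hr0 hB hc hσ hstep⟩
  refine h.exists_sum_M_le_of_isMixing
    (isMixing_ratioWeights hG hA hcol hI hrun.φ_zero hrun.φ_succ Bbar) hr0 hr hB
    (Real.sqrt_nonneg _) (Real.one_le_sqrt.2 hI1) ?_ hc hσ hstep
  rw [mul_comm]
  exact mul_le_mul_of_nonneg_right ((Real.sqrt_le_left (by linarith)).2 (by nlinarith))
    (Real.sqrt_nonneg _)

lemma exists_sum_M_le_of_doublyStochastic (hI : 1 ≤ I) (hP : P.Standing L LG)
    (hG : IsBStronglyConnected G B) (hA : IsCompliant G A κ) (hcol : ColumnStochastic A)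
    (hrow : RowStochastic A) (hft : IsSurrogate P ft gft τ Lt) (hσ : σ ∈ Set.Ioo (0 : ℝ) 1)
    (hα : 0 < α) (hrun : IsRun P ft A α x xt y φ)
    (hstep : StepBound L Lt LG τ σ 1 B 1 1 (√(1 - κ / (2 * (I : ℝ) ^ 2))) α) :
    ∃ C, ∀ N, ∑ n ∈ range N, M P (x n) ≤ C := by
  have hI1 : (1 : ℝ) ≤ I := by exact_mod_cast hI
  have hφ : ∀ n i, φ n i = 1 := by
    intro n
    induction n with
    | zero => exact hrun.φ_zero
    | succ n ih => exact fun i => by simp_rw [hrun.φ_succ, ih, mul_one, hrow n i]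
  have hW : ratioWeights A φ = A := by
    funext n i j
    simp [ratioWeights, hφ]
  have hp : mass φ = fun _ _ => 1 / (I : ℝ) := by
    funext n i
    rw [mass, hφ]
  have h : IsBoundedRun P L LG ft gft τ Lt A α x xt y φ 1 1 :=
    ⟨hI, hP, hft, hrun, hA.nonneg, hcol, one_pos, fun n i => (hφ n i).ge, fun n i => (hφ n i).le,
      hα, step_le_one_of_stepBound (Real.sqrt_nonneg _) hG.1 le_rfl hσ hstep⟩
  have hr : √(1 - κ / (2 * (I : ℝ) ^ 2)) < 1 := by
    have : 0 < κ / (2 * (I : ℝ) ^ 2) := div_pos hA.κ_pos (by positivity)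
    rw [Real.sqrt_lt' one_pos]
    linarith
  refine h.exists_sum_M_le_of_isMixing (c' := 1) (ω := 1) ?_ (Real.sqrt_nonneg _) hr hG.1
    zero_le_one le_rfl (by norm_num) le_rfl hσ hstep
  rw [hW, hp]
  exact isMixing_of_doublyStochastic hG hA hcol hrow hI

/-- A sequence with partial sums bounded by `C` falls to `ε` within `C / ε` steps. -/
lemma exists_isLeast_le_div {a : ℕ → ℝ} {C : ℝ} (h : ∀ N, ∑ n ∈ range N, a n ≤ C) {ε : ℝ}
    (hε : 0 < ε) : ∃ T : ℕ, IsLeast {n : ℕ | a n ≤ ε} T ∧ (T : ℝ) ≤ C / ε := by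
  classical
  have key : ∀ N : ℕ, (∀ n < N, ε < a n) → (N : ℝ) ≤ C / ε := by
    intro N hN
    rw [le_div_iff₀ hε]
    have h1 := card_nsmul_le_sum (range N) a ε fun n hn => (hN n (mem_range.1 hn)).le
    rw [card_range, nsmul_eq_mul] at h1
    exact h1.trans (h N)
  have hex : ∃ n, a n ≤ ε := by
    by_contra! hall
    obtain ⟨N, hN⟩ := exists_nat_gt (C / ε)
    exact absurd (key N fun n _ => hall n) (not_le.2 hN)
  exact ⟨Nat.find hex, ⟨Nat.find_spec hex, fun n hn => Nat.find_min' hex hn⟩,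
    key _ fun n hn => not_le.1 (Nat.find_min hex hn)⟩

end Regimes

end Sonata

theorem theorem2 {I m : ℕ} (hI : 1 ≤ I)
    (P : Sonata.Problem I m) (L : Fin I → NNReal) (LG : NNReal) (hP : P.Standing L LG)
    (G : ℕ → Digraph (Fin I)) (B : ℕ) (hG : Sonata.IsBStronglyConnected G B)
    (A : ℕ → Matrix (Fin I) (Fin I) ℝ) (κ : ℝ) (hA : Sonata.IsCompliant G A κ)
    (hcol : Sonata.ColumnStochastic A)
    (ft : Fin I → Sonata.Vec m → Sonata.Vec m → ℝ)
    (gft : Fin I → Sonata.Vec m → Sonata.Vec m → Sonata.Vec m)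
    (τ : Fin I → ℝ) (Lt : Fin I → NNReal) (hft : Sonata.IsSurrogate P ft gft τ Lt)
    (σ : ℝ) (hσ : σ ∈ Set.Ioo (0 : ℝ) 1)
    (α : ℝ) (hα : 0 < α) (hstep : Sonata.FixedStep A B κ L Lt LG τ σ α)
    (x xt y : ℕ → Fin I → Sonata.Vec m) (φ : ℕ → Fin I → ℝ)
    (hrun : Sonata.IsRun P ft A α x xt y φ) :
    ∃ C : ℝ, ∀ ε : ℝ, 0 < ε →
      ∃ T : ℕ, IsLeast {n : ℕ | Sonata.M P (x n) ≤ ε} T ∧ (T : ℝ) ≤ C / ε := by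
  have hsum : ∃ C, ∀ N, ∑ n ∈ Finset.range N, Sonata.M P (x n) ≤ C := by
    rcases hstep with ⟨Bbar, hr, hstep⟩ | ⟨hrow, hstep⟩
    · exact Sonata.exists_sum_M_le_of_columnStochastic hI hP hG hA hcol hft hσ hα hrun hr hstep
    · exact Sonata.exists_sum_M_le_of_doublyStochastic hI hP hG hA hcol hrow hft hσ hα hrun hstep
  obtain ⟨C, hC⟩ := hsum
  exact ⟨C, fun ε hε => Sonata.exists_isLeast_le_div hC hε⟩
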